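/- For a knot $K\subset S^3$ with Seifert matrix $M$ and $t\in\mathbb{R}$ let $\sigma_t(K)$ be the Tristram–Levine signature of $K$ at $\omega=e^{2\pi i t}$, that is, the signature of the Hermitian matrix $(1-\omega)M+(1-\bar\omega)M^{\mathsf T}$. The jump of $\sigma_t(K)$ at $t_0\in(0,1)$ is $\lim_{t\to t_0^+}\sigma_t(K)-\lim_{t\to t_0^-}\sigma_t(K)$, and $t_0\in(0,1)$ is a jump point if these one-sided limits differ. Let $0<p<q$ be coprime integers and let $T_{p,q}$ be the positive torus knot, the closure of the braid $(\sigma_1\sigma_2\cdots\sigma_{p-1})^q$ on $p$ strands. (Conventions are such that the positive trefoil $T_{2,3}$ has $\sigma_{1/2}=-2$.) Then the function $t\mapsto\sigma_t(T_{p,q})$ is monotonically decreasing (that is, non-increasing) on $[0,\frac{p+q}{pq})$. More precisely, its jump points in $[0,\frac{p+q}{pq})$ are exactly the points $\frac{\ell}{pq}$ of this interval with $\ell$ an integer, $p\nmid\ell$ and $q\nmid\ell$, and each of these jumps is $-2$. Furthermore, if $p\ge 2$, the jump at $\frac{p+q}{pq}$ is $2$. For integers $\ell$ with $0\le\ell<p+q$,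 $$\sigma_t(T_{p,q})=-2\left(\ell-\left\lfloor\tfrac{\ell}{q}\right\rfloor-\left\lfloor\tfrac{\ell}{p}\right\rfloor\right)\quad\text{for } t\in\left(\tfrac{\ell}{pq},\tfrac{\ell+1}{pq}\right),\ t<1$$ (the condition $t<1$ is automatic if $p\ge2$), and, if $p\ge2$, $$\sigma_t(T_{p,q})=-2\left(p+q-4-\left\lfloor\tfrac{q}{p}\right\rfloor\right)\quad\text{for } t\in\left(\tfrac{p+q}{pq},\tfrac{p+q+1}{pq}\right).$$ -/

import Mathlib

open Filter Topology
open scoped Matrix ComplexConjugate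

/-- A braid word on `m + 1` strands: the word `∏ₖ σ_{gen k}^{sign k}` of length `len` in the Artin
generators `σ₀, …, σ_{m-1}`, where `σᵢ` is the positive crossing of the strands in positions `i`
and `i + 1`. -/
structure BraidWord (m : ℕ) where
  /-- the number of letters (crossings) -/
  len : ℕ
  /-- the generator in position `k` -/
  gen : Fin len → Fin m
  /-- the exponent (the sign of the crossing) in position `k` -/
  sign : Fin len → ℤˣ

namespace BraidWord

variable {m : ℕ} (β : BraidWord m)

/-! ### The Seifert surface of a closed braid

Seifert's algorithm, applied to the closure of `β`, gives the following oriented surface `F` in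
three-space: horizontal unit disks `D₀, …, D_m`, with `Dᵢ` at height `i` and centred on the braid
axis, oriented by the upward normal, and for each letter `k` a vertical band, with a half twist of
sign `sign k`, which joins the boundary circles of `D_{gen k}` and `D_{gen k + 1}` at the angle
`θ_k`, where `0 < θ₀ < θ₁ < ⋯ < 2π`. Its boundary is the closure of `β`, and it is connected exactly
if every generator occurs in `β`.

The surface deformation retracts to the graph with a vertex for each disk and an edge for each
band. So `H₁(F; ℤ)` is the group of integral 1-cycles of that graph. -/

/-- The boundary map of the graph: the band of letter `k`, oriented upwards, runs from the disk
`D_{gen k}` to the disk `D_{gen k + 1}`. -/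
def boundary : (Fin β.len → ℤ) →ₗ[ℤ] (Fin (m + 1) → ℤ) :=
  Fintype.linearCombination ℤ fun k =>
    (Pi.single (β.gen k).succ 1 - Pi.single (β.gen k).castSucc 1 : Fin (m + 1) → ℤ)

/-- The first homology group `H₁(F; ℤ)` of the Seifert surface, as the group of 1-cycles: the
coordinate `x k` is the number of times that `x` runs upwards through the band `k`. -/
abbrev H₁ : Submodule ℤ (Fin β.len → ℤ) := LinearMap.ker β.boundary

/-- The coefficient of `x k * y l` in the linking number `lk(x, y⁺)` of 1-cycles `x, y` of `F`,
where `y⁺` is `y` pushed off `F` in the direction of the positive (upward) normal, and where inside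
a disk `x` and `y` run along radii between the centre and the bands:

* `k = l`: the half twist of a band contributes `0` if it is positive and `1` if it is negative
  (so that the core `x` of an annulus made of the bands `k, l` has
  `lk(x, x⁺) = -(sign k + sign l) / 2`: the core of a positive Hopf band has `lk(x, x⁺) = -1`);
* `l < k`, both bands between the same two disks: `1`;
* `l < k`, the band `k` right above the band `l`, with the disk `D_{gen k}` in common: `-1`, from
  the crossings of the chords of `x` with those of `y` in that disk, above which `y⁺` runs;
* otherwise `0`: in particular if the band `k` is right below the band `l`, since then `y⁺` lies
  above that part of `x`. -/
def linkCoeff (k l : Fin β.len) : ℤ :=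
  if k = l then (if β.sign k = 1 then 0 else 1)
  else if l < k then
    (if β.gen k = β.gen l then 1
    else if (β.gen k : ℕ) = (β.gen l : ℕ) + 1 then -1
    else 0)
  else 0

/-- The Seifert form `(x, y) ↦ lk(x, y⁺)` on `H₁(F; ℤ)`. -/
def seifertForm (x y : β.H₁) : ℤ :=
  ∑ k, ∑ l, β.linkCoeff k l * x.1 k * y.1 l

end BraidWord

/-- The enlargement of `M` by the rows and columns
`(M ξ 0 ; 0 0 1 ; 0 0 0)`. -/
def Matrix.enlargeCol {n : ℕ} (M : Matrix (Fin n) (Fin n) ℤ) (ξ : Fin n → ℤ) :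
    Matrix (Fin (n + 2)) (Fin (n + 2)) ℤ :=
  Matrix.reindex finSumFinEquiv finSumFinEquiv
    (Matrix.fromBlocks M (Matrix.of fun i => ![ξ i, 0]) 0 !![0, 1; 0, 0])

/-- The enlargement of `M` by the rows and columns
`(M 0 0 ; η 0 0 ; 0 1 0)`. -/
def Matrix.enlargeRow {n : ℕ} (M : Matrix (Fin n) (Fin n) ℤ) (η : Fin n → ℤ) :
    Matrix (Fin (n + 2)) (Fin (n + 2)) ℤ :=
  Matrix.reindex finSumFinEquiv finSumFinEquiv
    (Matrix.fromBlocks M 0 (Matrix.of ![η, 0]) !![0, 0; 1, 0])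

/-- The S-equivalence class of Seifert matrices of the closure of `β` (for `β` a word in which
every generator occurs). It holds the matrix `lk(bᵢ, bⱼ⁺)` of the Seifert form of the surface `F`
of `β` in each basis `b` of `H₁(F; ℤ)`, and it is closed under change of basis and under adding and
removing tubes. Any two Seifert surfaces of a link are related by ambient isotopy and by adding and
removing tubes, so every Seifert matrix of the link, for any connected Seifert surface and any
basis, is in this class. -/
inductive IsSeifertMatrix {m : ℕ} (β : BraidWord m) :
    {n : ℕ} → Matrix (Fin n) (Fin n) ℤ → Prop
  | surface {n : ℕ} (b : Module.Basis (Fin n) ℤ β.H₁) :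
      IsSeifertMatrix β (Matrix.of fun i j => β.seifertForm (b i) (b j))
  | baseChange {n : ℕ} {M : Matrix (Fin n) (Fin n) ℤ} (P : Matrix (Fin n) (Fin n) ℤ)
      (hP : IsUnit P.det) (h : IsSeifertMatrix β M) : IsSeifertMatrix β (P * M * Pᵀ)
  | addCol {n : ℕ} {M : Matrix (Fin n) (Fin n) ℤ} (ξ : Fin n → ℤ)
      (h : IsSeifertMatrix β M) : IsSeifertMatrix β (M.enlargeCol ξ)
  | addRow {n : ℕ} {M : Matrix (Fin n) (Fin n) ℤ} (η : Fin n → ℤ)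
      (h : IsSeifertMatrix β M) : IsSeifertMatrix β (M.enlargeRow η)
  | removeCol {n : ℕ} {M : Matrix (Fin n) (Fin n) ℤ} (ξ : Fin n → ℤ)
      (h : IsSeifertMatrix β (M.enlargeCol ξ)) : IsSeifertMatrix β M
  | removeRow {n : ℕ} {M : Matrix (Fin n) (Fin n) ℤ} (η : Fin n → ℤ)
      (h : IsSeifertMatrix β (M.enlargeRow η)) : IsSeifertMatrix β M

/-- Every closed braid has a Seifert matrix. -/
theorem exists_isSeifertMatrix {m : ℕ} (β : BraidWord m) :
    ∃ (n : ℕ) (M : Matrix (Fin n) (Fin n) ℤ), IsSeifertMatrix β M :=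
  ⟨_, _, IsSeifertMatrix.surface (Module.finBasis ℤ β.H₁)⟩

/-- The braid word `(σ₀ σ₁ ⋯ σ_{p-2})^q` on `p` strands (for `1 ≤ p`), whose closure is the
positive torus link `T_{p,q}`. -/
def torusBraid (p q : ℕ) : BraidWord (p - 1) where
  len := q * (p - 1)
  gen k := k.modNat
  sign _ := 1

/-- The matrix `(1 - ω) M + (1 - ω̄) Mᵀ`. -/
noncomputable def tristramLevineMatrix {n : ℕ} (M : Matrix (Fin n) (Fin n) ℤ) (ω : ℂ) :
    Matrix (Fin n) (Fin n) ℂ :=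
  (1 - ω) • M.map (Int.cast : ℤ → ℂ) + (1 - conj ω) • (M.map (Int.cast : ℤ → ℂ))ᵀ

theorem tristramLevineMatrix_isHermitian {n : ℕ} (M : Matrix (Fin n) (Fin n) ℤ) (ω : ℂ) :
    (tristramLevineMatrix M ω).IsHermitian := by
  ext i j
  simp [tristramLevineMatrix, add_comm]

/-- The signature of a Hermitian matrix: the number of positive eigenvalues minus the number of
negative eigenvalues, with multiplicity. -/
noncomputable def Matrix.IsHermitian.signature {n : ℕ} {A : Matrix (Fin n) (Fin n) ℂ}
    (hA : A.IsHermitian) : ℤ :=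
  ((Finset.univ.filter fun i => 0 < hA.eigenvalues i).card : ℤ) -
    ((Finset.univ.filter fun i => hA.eigenvalues i < 0).card : ℤ)

/-- The Tristram–Levine signature function `t ↦ σ_t = σ_{exp(2πit)}` determined by a Seifert
matrix `M`. -/
noncomputable def tristramLevineSignature {n : ℕ} (M : Matrix (Fin n) (Fin n) ℤ) (t : ℝ) : ℤ :=
  (tristramLevineMatrix_isHermitian M (Complex.exp (2 * Real.pi * Complex.I * t))).signature

/-- `σ` has one-sided limits at `t₀ ∈ (0, 1)`, and the right limit minus the left limit is `j`. -/
def HasJump (σ : ℝ → ℤ) (t₀ : ℝ) (j : ℤ) : Prop :=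
  t₀ ∈ Set.Ioo (0 : ℝ) 1 ∧
    ∃ a b : ℤ, Tendsto σ (𝓝[<] t₀) (𝓝 a) ∧ Tendsto σ (𝓝[>] t₀) (𝓝 b) ∧ j = b - a

/-- `t₀ ∈ (0, 1)` is a jump point of `σ`: the one-sided limits of `σ` at `t₀` differ. -/
def IsJumpPoint (σ : ℝ → ℤ) (t₀ : ℝ) : Prop :=
  ∃ j : ℤ, j ≠ 0 ∧ HasJump σ t₀ j

open Matrix

/-! ### Signatures of complex matrices up to congruence -/

namespace Matrix

variable {ι κ : Type*} [Fintype ι] [Fintype κ]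

/-! The Seifert form of the braid surface can be diagonalised explicitly. On 1-chains the linking
form is `L ⊗ 1 - (L + 1) ⊗ N`, with `L` the strictly lower triangular matrix of ones on the `q`
blocks and `N` the subdiagonal matrix on the `p - 1` generators; cycles are the chains whose sum
over the blocks vanishes for every generator. Powers of a nontrivial `q`-th root of unity, tensored
with phase-twisted sine vectors, form a basis of the complex cycles that diagonalises the form at `ω
= e^{2πit}` (`torusEigenvectors_diagonalize`). For `0 < t < 1` this gives `σ_t = ∑ sign (|t - k/q| -
j/p)` over `0 < k < q`, `0 < j < p`. Every other matrix in the S-equivalence class has the same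
signature: a base change is a congruence, and a tube adds a hyperbolic plane
(`IsSeifertMatrix.hasSignature`).

The rest is lattice point counting. Put `T = pqt` and call the numbers `v = kp + jq` weights. The
identity `sign_abs_sub` turns the sum into `∑ (1 + sign (T - v)) - ∑ sign (T + pq - v)`. For coprime
`p`, `q` the weights are distinct, and the smallest is `p + q`. So for `T < p + q` the first sum is
zero and `σ` is minus a nondecreasing step function, which vanishes at `T = 0` by the symmetry `v ↦
2pq - v`. Its steps have height 2 and lie at the `T = v - pq`; for `0 ≤ x < p + q` the number `pq +
x` is a weight exactly if neither `p` nor `q` divides `x` (`not_dvd_torusWeight`,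
`exists_torusWeight_eq`). At `T = p + q` the first sum steps up by 2, while the second is unaffected
because `pq + p + q` is not a weight (`torusWeight_ne`). -/

theorem star_mulVec_dotProduct (A P : Matrix ι ι ℂ) (x y : ι → ℂ) :
    star (P *ᵥ x) ⬝ᵥ (A *ᵥ (P *ᵥ y)) = star x ⬝ᵥ ((Pᴴ * A * P) *ᵥ y) := by
  rw [star_mulVec, ← dotProduct_mulVec]
  simp only [mulVec_mulVec, Matrix.mul_assoc]

theorem sum_sign_eq_card_sub_card (d : ι → ℝ) :
    ∑ i, (SignType.sign (d i) : ℤ) = ((Finset.univ.filter fun i => 0 < d i).card : ℤ) -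
      ((Finset.univ.filter fun i => d i < 0).card : ℤ) := by
  rw [Finset.card_filter, Finset.card_filter]
  push_cast
  rw [← Finset.sum_sub_distrib]
  refine Finset.sum_congr rfl fun i _ => ?_
  rcases lt_trichotomy (d i) 0 with h | h | h
  · simp [h, h.not_gt]
  · simp [h]
  · simp [h, h.not_gt]

variable [DecidableEq ι] [DecidableEq κ]

/-- `A` is congruent to a real diagonal matrix whose entries have signs of sum `s`. -/
def HasSignature (A : Matrix ι ι ℂ) (s : ℤ) : Prop :=
  ∃ (P : Matrix ι ι ℂ) (d : ι → ℝ), IsUnit P.det ∧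
    Pᴴ * A * P = diagonal (fun i => (d i : ℂ)) ∧ s = ∑ i, (SignType.sign (d i) : ℤ)

theorem star_dotProduct_diagonal_mulVec (d : ι → ℝ) (x : ι → ℂ) :
    star x ⬝ᵥ (diagonal (fun i => (d i : ℂ)) *ᵥ x) = ((∑ i, d i * Complex.normSq (x i) : ℝ) : ℂ) := by
  simp only [dotProduct, mulVec_diagonal, Pi.star_apply, Complex.ofReal_sum, Complex.ofReal_mul,
    Complex.normSq_eq_conj_mul_self]
  refine Finset.sum_congr rfl fun i _ => ?_
  simp only [RCLike.star_def]
  ring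

/-- Half of Sylvester's law of inertia. -/
theorem card_pos_le_of_congruent {d e : ι → ℝ} {R : Matrix ι ι ℂ}
    (h : Rᴴ * diagonal (fun i => (d i : ℂ)) * R = diagonal (fun i => (e i : ℂ))) :
    (Finset.univ.filter fun i => 0 < e i).card ≤ (Finset.univ.filter fun i => 0 < d i).card := by
  by_contra! hlt
  let ext : ({i // 0 < e i} → ℂ) →ₗ[ℂ] (ι → ℂ) := Function.ExtendByZero.linearMap ℂ Subtype.val
  -- If `d` had fewer positive entries than `e`, some nonzero `x` supported where `e > 0` would have
  -- `R x` vanishing wherever `d > 0`; the form would then be both positive and nonpositive on it.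
  let f : ({i // 0 < e i} → ℂ) →ₗ[ℂ] ({i // 0 < d i} → ℂ) :=
    (LinearMap.funLeft ℂ ℂ Subtype.val) ∘ₗ R.mulVecLin ∘ₗ ext
  have hker : LinearMap.ker f ≠ ⊥ := by
    apply LinearMap.ker_ne_bot_of_finrank_lt
    simpa [Module.finrank_fintype_fun_eq_card, Fintype.card_subtype] using hlt
  obtain ⟨y, hy, hy0⟩ := (Submodule.ne_bot_iff _).1 hker
  set x : ι → ℂ := ext y with hx
  have hxval : ∀ i : {i // 0 < e i}, x i = y i := fun i => by
    simp only [hx, ext, Function.ExtendByZero.linearMap_apply]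
    exact Subtype.val_injective.extend_apply y 0 i
  have hxzero : ∀ i, ¬ 0 < e i → x i = 0 := fun i hi => by
    simp only [hx, ext, Function.ExtendByZero.linearMap_apply]
    rw [Function.extend_apply' _ _ _ (by rintro ⟨a, rfl⟩; exact hi a.2)]
    rfl
  have hRx : ∀ i, 0 < d i → (R *ᵥ x) i = 0 := fun i hi => by
    have := congrFun (LinearMap.mem_ker.1 hy) ⟨i, hi⟩
    simpa [f, LinearMap.funLeft] using this
  have key := star_mulVec_dotProduct (diagonal (fun i => (d i : ℂ))) R x x
  rw [h, star_dotProduct_diagonal_mulVec, star_dotProduct_diagonal_mulVec] at key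
  have key' := Complex.ofReal_injective key
  have h1 : ∑ i, d i * Complex.normSq ((R *ᵥ x) i) ≤ 0 := by
    refine Finset.sum_nonpos fun i _ => ?_
    by_cases hi : 0 < d i
    · simp [hRx i hi]
    · exact mul_nonpos_of_nonpos_of_nonneg (not_lt.1 hi) (Complex.normSq_nonneg _)
  have h2 : 0 < ∑ i, e i * Complex.normSq (x i) := by
    obtain ⟨i, hi⟩ : ∃ i, y i ≠ 0 := by
      by_contra! hc
      exact hy0 (funext hc)
    refine Finset.sum_pos' (fun j _ => ?_) ⟨i, Finset.mem_univ _, ?_⟩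
    · by_cases hj : 0 < e j
      · exact mul_nonneg hj.le (Complex.normSq_nonneg _)
      · simp [hxzero j hj]
    · rw [hxval i]
      exact mul_pos i.2 (Complex.normSq_pos.2 hi)
  linarith

theorem card_neg_le_of_congruent {d e : ι → ℝ} {R : Matrix ι ι ℂ}
    (h : Rᴴ * diagonal (fun i => (d i : ℂ)) * R = diagonal (fun i => (e i : ℂ))) :
    (Finset.univ.filter fun i => e i < 0).card ≤ (Finset.univ.filter fun i => d i < 0).card := by
  have h' : Rᴴ * diagonal (fun i => ((-d i : ℝ) : ℂ)) * R =
      diagonal (fun i => ((-e i : ℝ) : ℂ)) := by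
    have hneg : ∀ f : ι → ℝ, diagonal (fun i => ((-f i : ℝ) : ℂ)) =
        -diagonal (fun i => (f i : ℂ)) := fun f => by
      ext i j; by_cases hij : i = j <;> simp [diagonal, hij]
    rw [hneg, hneg, Matrix.mul_neg, Matrix.neg_mul, h]
  simpa using card_pos_le_of_congruent h'

/-- Sylvester's law of inertia. -/
theorem HasSignature.unique {A : Matrix ι ι ℂ} {s s' : ℤ}
    (h : A.HasSignature s) (h' : A.HasSignature s') : s = s' := by
  obtain ⟨P, d, hP, hd, rfl⟩ := h
  obtain ⟨Q, e, hQ, he, rfl⟩ := h'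
  have aux : ∀ {P Q : Matrix ι ι ℂ} {d e : ι → ℝ}, IsUnit P.det →
      Pᴴ * A * P = diagonal (fun i => (d i : ℂ)) → Qᴴ * A * Q = diagonal (fun i => (e i : ℂ)) →
      (P⁻¹ * Q)ᴴ * diagonal (fun i => (d i : ℂ)) * (P⁻¹ * Q) =
        diagonal (fun i => (e i : ℂ)) := by
    intro P Q d e hP hd he
    have h1 : P * (P⁻¹ * Q) = Q := by
      rw [← Matrix.mul_assoc, Matrix.mul_nonsing_inv _ hP, Matrix.one_mul]
    calc _ = (P * (P⁻¹ * Q))ᴴ * A * (P * (P⁻¹ * Q)) := by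
          rw [← hd, conjTranspose_mul P]; simp only [Matrix.mul_assoc]
      _ = _ := by rw [h1, he]
  have h1 := aux hP hd he
  have h2 := aux hQ he hd
  rw [sum_sign_eq_card_sub_card, sum_sign_eq_card_sub_card,
    (card_pos_le_of_congruent h1).antisymm (card_pos_le_of_congruent h2),
    (card_neg_le_of_congruent h1).antisymm (card_neg_le_of_congruent h2)]

theorem IsHermitian.hasSignature {n : ℕ} {A : Matrix (Fin n) (Fin n) ℂ} (hA : A.IsHermitian) :
    A.HasSignature hA.signature := by
  refine ⟨hA.eigenvectorUnitary, hA.eigenvalues, ?_, ?_, ?_⟩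
  · exact (Matrix.isUnit_iff_isUnit_det _).1 (Unitary.isUnit_coe (U := hA.eigenvectorUnitary))
  · have := hA.conjStarAlgAut_star_eigenvectorUnitary
    rw [Unitary.conjStarAlgAut_apply] at this
    simpa [star_eq_conjTranspose, Function.comp_def] using this
  · rw [sum_sign_eq_card_sub_card]; rfl

theorem HasSignature.congr {A Q : Matrix ι ι ℂ} {s : ℤ} (h : A.HasSignature s)
    (hQ : IsUnit Q.det) : (Qᴴ * A * Q).HasSignature s := by
  obtain ⟨P, d, hP, hd, rfl⟩ := h
  refine ⟨Q⁻¹ * P, d, ?_, ?_, rfl⟩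
  · rw [det_mul]
    exact (Matrix.isUnit_nonsing_inv_det _ hQ).mul hP
  · have h1 : Q * (Q⁻¹ * P) = P := by
      rw [← Matrix.mul_assoc, Matrix.mul_nonsing_inv _ hQ, Matrix.one_mul]
    calc _ = (Q * (Q⁻¹ * P))ᴴ * A * (Q * (Q⁻¹ * P)) := by
          rw [conjTranspose_mul Q]; simp only [Matrix.mul_assoc]
      _ = _ := by rw [h1, hd]

theorem HasSignature.reindex {A : Matrix ι ι ℂ} {s : ℤ} (h : A.HasSignature s) (e : ι ≃ κ) :
    (Matrix.reindex e e A).HasSignature s := by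
  obtain ⟨P, d, hP, hd, rfl⟩ := h
  refine ⟨Matrix.reindex e e P, d ∘ e.symm, ?_, ?_, ?_⟩
  · rwa [det_reindex_self]
  · simp only [reindex_apply, conjTranspose_submatrix, submatrix_mul_equiv]
    rw [hd, submatrix_diagonal_equiv]
    rfl
  · exact (Equiv.sum_comp e.symm fun i => (SignType.sign (d i) : ℤ)).symm

theorem HasSignature.fromBlocks {A : Matrix ι ι ℂ} {D : Matrix κ κ ℂ} {s s' : ℤ}
    (h : A.HasSignature s) (h' : D.HasSignature s') :
    (Matrix.fromBlocks A 0 0 D).HasSignature (s + s') := by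
  obtain ⟨P, d, hP, hd, rfl⟩ := h
  obtain ⟨Q, e, hQ, he, rfl⟩ := h'
  refine ⟨Matrix.fromBlocks P 0 0 Q, Sum.elim d e, ?_, ?_, ?_⟩
  · rw [det_fromBlocks_zero₂₁]
    exact hP.mul hQ
  · rw [fromBlocks_conjTranspose, fromBlocks_multiply, fromBlocks_multiply]
    simp only [conjTranspose_zero, Matrix.zero_mul, Matrix.mul_zero, add_zero, zero_add, hd, he,
      fromBlocks_diagonal]
    congr 1
    ext (i | i) <;> rfl
  · simp

theorem hasSignature_hyperbolic {β : ℂ} (hβ : β ≠ 0) :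
    (!![0, β; conj β, 0] : Matrix (Fin 2) (Fin 2) ℂ).HasSignature 0 := by
  have hβ' : conj β ≠ 0 := by simpa using hβ
  -- The columns are the sum and the difference of two isotropic vectors with pairing 1, hence the
  -- values 2 and -2.
  refine ⟨!![1, 1; β⁻¹, -β⁻¹], ![2, -2], ?_, ?_, ?_⟩
  · rw [det_fin_two_of, isUnit_iff_ne_zero]
    have : (1 * -β⁻¹ - 1 * β⁻¹ : ℂ) = -2 * β⁻¹ := by ring
    rw [this]
    simp [hβ]
  · ext i j
    fin_cases i <;> fin_cases j <;> simp [Matrix.mul_apply, Fin.sum_univ_two, hβ, hβ'] <;> norm_num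
  · simp

/-- Shifting the `i`-th basis vector by `β⁻¹ zᵢ` times the second vector of the hyperbolic plane
creates the off-diagonal blocks. As that vector is isotropic and orthogonal to `A`, the block `A`
does not change. -/
theorem HasSignature.enlarge {A : Matrix ι ι ℂ} {s : ℤ} (h : A.HasSignature s) {β : ℂ}
    (hβ : β ≠ 0) (z : ι → ℂ) :
    (Matrix.fromBlocks A (of fun i => ![conj (z i), 0]) (of ![z, 0])
      !![0, β; conj β, 0]).HasSignature s := by
  have h2 := h.fromBlocks (hasSignature_hyperbolic hβ)
  have h3 := h2.congr (Q := Matrix.fromBlocks 1 0 (of ![0, fun i => β⁻¹ * z i]) 1) (by simp)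
  rw [add_zero] at h3
  convert h3 using 1
  have hβ' : conj β ≠ 0 := by simpa using hβ
  rw [fromBlocks_conjTranspose, fromBlocks_multiply, fromBlocks_multiply]
  congr 1
  · ext i j
    simp [Matrix.mul_apply, Fin.sum_univ_two]
  · ext i j
    fin_cases j <;> simp [Matrix.mul_apply, Fin.sum_univ_two, mul_right_comm, hβ']
  · ext i j
    fin_cases i <;> simp [hβ]
  · simp

end Matrix

/-! ### Invariance of the signature in the S-equivalence class -/

namespace Matrix

variable {ι κ : Type*}

/-- The matrix `α M + ᾱ Mᵀ`. -/
noncomputable def hermitize (α : ℂ) (M : Matrix ι ι ℤ) : Matrix ι ι ℂ :=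
  α • M.map (Int.cast : ℤ → ℂ) + conj α • (M.map (Int.cast : ℤ → ℂ))ᵀ

theorem hermitize_submatrix (α : ℂ) (M : Matrix ι ι ℤ) (f : κ → ι) :
    hermitize α (M.submatrix f f) = (hermitize α M).submatrix f f := rfl

theorem hermitize_congr [Fintype ι] (α : ℂ) (M : Matrix ι ι ℤ) (P : Matrix κ ι ℤ) :
    hermitize α (P * M * Pᵀ) =
      ((P.map (Int.cast : ℤ → ℂ))ᵀ)ᴴ * hermitize α M * (P.map (Int.cast : ℤ → ℂ))ᵀ := by
  have hP : ((P.map (Int.cast : ℤ → ℂ))ᵀ)ᴴ = P.map (Int.cast : ℤ → ℂ) := by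
    ext i j; simp
  have h1 : (P * M * Pᵀ).map (Int.cast : ℤ → ℂ) = P.map (Int.cast : ℤ → ℂ) *
      M.map (Int.cast : ℤ → ℂ) * (P.map (Int.cast : ℤ → ℂ))ᵀ := by
    ext i j
    simp [Matrix.mul_apply]
  rw [hP, hermitize, hermitize, h1]
  simp only [transpose_mul, transpose_transpose, Matrix.mul_add, Matrix.add_mul, Matrix.mul_smul,
    Matrix.smul_mul, Matrix.mul_assoc]

theorem HasSignature.hermitize_congr [Fintype ι] [DecidableEq ι] {α : ℂ} {M : Matrix ι ι ℤ}
    {s : ℤ} (h : (hermitize α M).HasSignature s) {P : Matrix ι ι ℤ} (hP : IsUnit P.det) :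
    (hermitize α (P * M * Pᵀ)).HasSignature s := by
  rw [Matrix.hermitize_congr]
  refine h.congr ?_
  rw [det_transpose]
  have : (P.map (Int.cast : ℤ → ℂ)).det = ((P.det : ℤ) : ℂ) := by
    simpa using (RingHom.map_det (Int.castRingHom ℂ) P).symm
  rw [this]
  exact hP.map (Int.castRingHom ℂ)

variable {n : ℕ}

theorem HasSignature.hermitize_enlargeCol {α : ℂ} (hα : α ≠ 0) {M : Matrix (Fin n) (Fin n) ℤ}
    {s : ℤ} (h : (hermitize α M).HasSignature s) (ξ : Fin n → ℤ) :
    (hermitize α (M.enlargeCol ξ)).HasSignature s := by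
  have h1 := (h.enlarge hα fun i => conj α * ξ i).reindex finSumFinEquiv
  convert h1 using 1
  rw [enlargeCol, reindex_apply, reindex_apply, hermitize_submatrix]
  congr 1
  ext (i | i) (j | j)
  · simp [hermitize]
  · fin_cases j <;> simp [hermitize]
  · fin_cases i <;> simp [hermitize]
  · fin_cases i <;> fin_cases j <;> simp [hermitize]

theorem HasSignature.hermitize_enlargeRow {α : ℂ} (hα : α ≠ 0) {M : Matrix (Fin n) (Fin n) ℤ}
    {s : ℤ} (h : (hermitize α M).HasSignature s) (η : Fin n → ℤ) :
    (hermitize α (M.enlargeRow η)).HasSignature s := by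
  have hα' : conj α ≠ 0 := by simpa using hα
  have h1 := (h.enlarge hα' fun i => α * η i).reindex finSumFinEquiv
  convert h1 using 1
  rw [enlargeRow, reindex_apply, reindex_apply, hermitize_submatrix]
  congr 1
  ext (i | i) (j | j)
  · simp [hermitize]
  · fin_cases j <;> simp [hermitize]
  · fin_cases i <;> simp [hermitize]
  · fin_cases i <;> fin_cases j <;> simp [hermitize]

theorem exists_hasSignature_hermitize (α : ℂ) (M : Matrix (Fin n) (Fin n) ℤ) :
    ∃ s, (hermitize α M).HasSignature s := by
  have h : (hermitize α M).IsHermitian := by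
    ext i j
    simp [hermitize, add_comm]
  exact ⟨_, h.hasSignature⟩

end Matrix

namespace BraidWord

variable {m : ℕ} (β : BraidWord m)

theorem seifertForm_matrix {ι : Type*} (b : ι → β.H₁) :
    (of fun i j => β.seifertForm (b i) (b j)) =
      (of fun i k => (b i).1 k) * of β.linkCoeff * (of fun i k => (b i).1 k)ᵀ := by
  ext i j
  simp only [seifertForm, of_apply, Matrix.mul_apply, transpose_apply, Finset.sum_mul]
  rw [Finset.sum_comm]
  exact Finset.sum_congr rfl fun k _ => Finset.sum_congr rfl fun l _ => by ring

/-- Two bases differ by an integral matrix of unit determinant. The index type of `f` is free, so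
that a basis indexed by pairs (block, generator) can be used. -/
theorem hasSignature_of_basis {ι : Type*} [Fintype ι] [DecidableEq ι] {α : ℂ} {s : ℤ}
    (f : Module.Basis ι ℤ β.H₁)
    (hf : (hermitize α (of fun i j => β.seifertForm (f i) (f j))).HasSignature s)
    {n : ℕ} (b : Module.Basis (Fin n) ℤ β.H₁) :
    (hermitize α (of fun i j => β.seifertForm (b i) (b j))).HasSignature s := by
  let e : ι ≃ Fin n := f.indexEquiv b
  let g := f.reindex e
  have hg : (hermitize α (of fun i j => β.seifertForm (g i) (g j))).HasSignature s := by
    have := hf.reindex e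
    rw [reindex_apply, ← hermitize_submatrix] at this
    convert this using 2
    ext i j
    simp [g]
  have hQ : IsUnit ((g.toMatrix b)ᵀ).det := by
    rw [det_transpose]
    exact IsUnit.of_mul_eq_one (b.toMatrix g).det
      (by rw [← det_mul, Module.Basis.toMatrix_mul_toMatrix_flip, det_one])
  have := hg.hermitize_congr hQ
  convert this using 2
  rw [seifertForm_matrix, seifertForm_matrix]
  have hB : (of fun i k => (b i).1 k) = (g.toMatrix b)ᵀ * (of fun i k => (g i).1 k) := by
    ext i k
    have h1 := g.sum_toMatrix_smul_self b i
    have h2 := congrFun (congrArg β.H₁.subtype h1) k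
    rw [map_sum, Finset.sum_apply] at h2
    exact h2.symm
  rw [hB]
  simp only [transpose_mul, Matrix.mul_assoc]

end BraidWord

/-- One basis of one surface decides the whole class. The condition `α ≠ 0`, that is `ω ≠ 1`, keeps
the block of a tube nondegenerate. -/
theorem IsSeifertMatrix.hasSignature {m : ℕ} {β : BraidWord m} {ι : Type*} [Fintype ι]
    [DecidableEq ι] {α : ℂ} (hα : α ≠ 0) {s : ℤ} (f : Module.Basis ι ℤ β.H₁)
    (hf : (hermitize α (of fun i j => β.seifertForm (f i) (f j))).HasSignature s)
    {n : ℕ} {M : Matrix (Fin n) (Fin n) ℤ} (hM : IsSeifertMatrix β M) :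
    (hermitize α M).HasSignature s := by
  induction hM with
  | surface b => exact β.hasSignature_of_basis f hf b
  | baseChange P hP _ ih => exact ih.hermitize_congr hP
  | addCol ξ _ ih => exact ih.hermitize_enlargeCol hα ξ
  | addRow η _ ih => exact ih.hermitize_enlargeRow hα η
  -- The smaller matrix has some signature; enlarging preserves it, so uniqueness identifies it with
  -- `s`.
  | @removeCol n M ξ _ ih =>
    obtain ⟨s', hs'⟩ := exists_hasSignature_hermitize α M
    rwa [ih.unique (hs'.hermitize_enlargeCol hα ξ)]
  | @removeRow n M η _ ih =>
    obtain ⟨s', hs'⟩ := exists_hasSignature_hermitize α M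
    rwa [ih.unique (hs'.hermitize_enlargeRow hα η)]

theorem tristramLevineSignature_eq_of_hasSignature {n : ℕ} {M : Matrix (Fin n) (Fin n) ℤ} {t : ℝ}
    {s : ℤ} (h : (hermitize (1 - Complex.exp (2 * Real.pi * Complex.I * t)) M).HasSignature s) :
    tristramLevineSignature M t = s := by
  refine (tristramLevineMatrix_isHermitian M _).hasSignature.unique ?_
  convert h using 1
  simp [tristramLevineMatrix, hermitize]

theorem tristramLevineSignature_eq_zero {n : ℕ} (M : Matrix (Fin n) (Fin n) ℤ) {t : ℝ}
    (h : Complex.exp (2 * Real.pi * Complex.I * t) = 1) : tristramLevineSignature M t = 0 := by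
  apply tristramLevineSignature_eq_of_hasSignature
  rw [h]
  exact ⟨1, 0, by simp, by ext i j; by_cases hij : i = j <;> simp [hermitize, hij], by simp⟩

/-! ### The Seifert form of a torus braid -/

namespace BraidWord

variable {m : ℕ} (β : BraidWord m)

theorem boundary_apply (x : Fin β.len → ℤ) :
    β.boundary x = ∑ i : Fin m, (∑ k with β.gen k = i, x k) •
      (Pi.single i.succ 1 - Pi.single i.castSucc 1 : Fin (m + 1) → ℤ) := by
  rw [boundary, Fintype.linearCombination_apply, ← Finset.sum_fiberwise _ β.gen]
  refine Finset.sum_congr rfl fun i _ => ?_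
  rw [Finset.sum_smul]
  refine Finset.sum_congr rfl fun k hk => ?_
  rw [(Finset.mem_filter.1 hk).2]

/-- A 1-chain is a cycle if and only if, for each generator, the coefficients of the bands of that
generator add up to zero. -/
theorem mem_H₁_iff (x : Fin β.len → ℤ) :
    x ∈ β.H₁ ↔ ∀ i : Fin m, ∑ k with β.gen k = i, x k = 0 := by
  rw [LinearMap.mem_ker, boundary_apply]
  refine ⟨fun h i => ?_, fun h => Finset.sum_eq_zero fun i _ => by rw [h i, zero_smul]⟩
  -- Summing over the disks above disk `i` isolates generator `i`: only its bands cross this cut.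
  have h1 := congrArg (fun y : Fin (m + 1) → ℤ => ∑ v with i.castSucc < v, y v) h
  simp only [Finset.sum_apply, Pi.zero_apply, Finset.sum_const_zero] at h1
  rw [Finset.sum_comm] at h1
  have h2 : ∀ (j : Fin m) (c : ℤ), ∑ v with i.castSucc < v,
      (c • (Pi.single j.succ 1 - Pi.single j.castSucc 1 : Fin (m + 1) → ℤ)) v =
      if j = i then c else 0 := by
    intro j c
    simp only [Pi.smul_apply, smul_eq_mul, Pi.sub_apply]
    rw [← Finset.mul_sum, Finset.sum_sub_distrib]
    simp only [Pi.single_apply, Finset.sum_ite_eq', Finset.mem_filter, Finset.mem_univ, true_and]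
    simp only [Fin.lt_def, Fin.val_succ, Fin.val_castSucc, Fin.ext_iff]
    rcases lt_trichotomy (j : ℕ) i with hj | hj | hj
    · rw [if_neg (by omega), if_neg (by omega), if_neg (by omega)]; ring
    · rw [if_pos (by omega), if_neg (by omega), if_pos hj]; ring
    · rw [if_pos (by omega), if_pos (by omega), if_neg (by omega)]; ring
  simp only [h2] at h1
  simpa using h1

end BraidWord

/-- The position in the torus braid word of the `i`-th letter of the `a`-th block. -/
def torusBraidIndex (p q : ℕ) : Fin q × Fin (p - 1) ≃ Fin (torusBraid p q).len := finProdFinEquiv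

theorem torusBraid_gen (p q : ℕ) (x : Fin q × Fin (p - 1)) :
    (torusBraid p q).gen (torusBraidIndex p q x) = x.2 :=
  congrArg Prod.snd (finProdFinEquiv.symm_apply_apply x)

theorem torusBraidIndex_lt (p q : ℕ) (x y : Fin q × Fin (p - 1)) :
    torusBraidIndex p q x < torusBraidIndex p q y ↔ x.1 < y.1 ∨ x.1 = y.1 ∧ x.2 < y.2 := by
  obtain ⟨a, i⟩ := x
  obtain ⟨b, j⟩ := y
  have h : torusBraidIndex p q (a, i) < torusBraidIndex p q (b, j) ↔
      (i : ℕ) + (p - 1) * a < j + (p - 1) * b := Iff.rfl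
  rw [h]
  simp only [Fin.lt_def, Fin.ext_iff]
  have hi := i.isLt
  have hj := j.isLt
  rcases lt_trichotomy (a : ℕ) b with hab | hab | hab
  · have : (p - 1) * (a + 1) ≤ (p - 1) * (b : ℕ) := Nat.mul_le_mul_left _ hab
    simp only [hab, true_or, iff_true]
    rw [mul_add] at this
    omega
  · simp [hab]
  · have : (p - 1) * (b + 1) ≤ (p - 1) * (a : ℕ) := Nat.mul_le_mul_left _ hab
    simp only [hab.not_gt, hab.ne', false_or, false_and, iff_false]
    rw [mul_add] at this
    omega

theorem mem_H₁_torusBraid_iff (p q : ℕ) (x : Fin (torusBraid p q).len → ℤ) :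
    x ∈ (torusBraid p q).H₁ ↔ ∀ i, ∑ a, x (torusBraidIndex p q (a, i)) = 0 := by
  rw [BraidWord.mem_H₁_iff]
  refine forall_congr' fun i => ?_
  have : ∑ k with (torusBraid p q).gen k = i, x k = ∑ a, x (torusBraidIndex p q (a, i)) := by
    rw [Finset.sum_filter, ← (torusBraidIndex p q).sum_comp, Fintype.sum_prod_type]
    refine Finset.sum_congr rfl fun a _ => ?_
    simp [torusBraid_gen]
  rw [this]

/-- Extend a function on `Fin r` to `Fin (r + 1)` such that the values add up to zero. -/
def extendSumZero {r m : ℕ} (y : Fin r × Fin m → ℤ) : Fin (r + 1) × Fin m → ℤ :=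
  fun x => Fin.cases (-∑ a, y (a, x.2)) (fun a => y (a, x.2)) x.1

/-- A cycle of the Seifert surface of a torus braid is determined by its coefficients outside the
first block of letters. -/
def torusBraidH₁Equiv (p r : ℕ) :
    (torusBraid p (r + 1)).H₁ ≃ₗ[ℤ] (Fin r × Fin (p - 1) → ℤ) where
  toFun x y := x.1 (torusBraidIndex p (r + 1) (y.1.succ, y.2))
  map_add' _ _ := rfl
  map_smul' _ _ := rfl
  invFun y := ⟨fun k => extendSumZero y ((torusBraidIndex p (r + 1)).symm k), by
    rw [mem_H₁_torusBraid_iff]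
    intro i
    simp [extendSumZero, Fin.sum_univ_succ]⟩
  left_inv x := by
    ext k
    obtain ⟨⟨a, i⟩, rfl⟩ := (torusBraidIndex p (r + 1)).surjective k
    simp only [Equiv.symm_apply_apply, extendSumZero]
    refine Fin.cases ?_ (fun a => ?_) a
    · have := (mem_H₁_torusBraid_iff p (r + 1) x.1).1 x.2 i
      rw [Fin.sum_univ_succ] at this
      simp only [Fin.cases_zero]
      omega
    · rfl
  right_inv y := by
    ext ⟨a, i⟩
    simp [extendSumZero]

/-- The basis of the first homology group of the Seifert surface of a torus braid which is given
by the cycles through one band of the first block and one other band of the same generator. -/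
noncomputable def torusBraidBasis (p r : ℕ) :
    Module.Basis (Fin r × Fin (p - 1)) ℤ (torusBraid p (r + 1)).H₁ :=
  Module.Basis.ofEquivFun (torusBraidH₁Equiv p r)

theorem torusBraidBasis_apply (p r : ℕ) (y : Fin r × Fin (p - 1)) (x : Fin (r + 1) × Fin (p - 1)) :
    (torusBraidBasis p r y).1 (torusBraidIndex p (r + 1) x) = extendSumZero (Pi.single y 1) x := by
  rw [torusBraidBasis, Module.Basis.coe_ofEquivFun]
  change extendSumZero _ ((torusBraidIndex p (r + 1)).symm _) = _
  rw [Equiv.symm_apply_apply]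

/-- The strictly lower triangular matrix of ones. -/
def lowerOnes (R : Type*) [Zero R] [One R] (q : ℕ) : Matrix (Fin q) (Fin q) R :=
  of fun a b => if b < a then 1 else 0

/-- The matrix with ones right below the diagonal. -/
def subdiagOnes (R : Type*) [Zero R] [One R] (m : ℕ) : Matrix (Fin m) (Fin m) R :=
  of fun i j => if (i : ℕ) = j + 1 then 1 else 0

/-- The matrix of the linking coefficients of a torus braid. -/
def torusLinkMatrix (q m : ℕ) : Matrix (Fin q × Fin m) (Fin q × Fin m) ℤ :=
  of fun x y => lowerOnes ℤ q x.1 y.1 * (1 : Matrix (Fin m) (Fin m) ℤ) x.2 y.2 -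
    (lowerOnes ℤ q x.1 y.1 + (1 : Matrix (Fin q) (Fin q) ℤ) x.1 y.1) * subdiagOnes ℤ m x.2 y.2

/-- All crossings are positive, so the diagonal vanishes. The letter `j + 1` of block `a` comes
after the letter `j` of block `b` exactly if `b ≤ a`, which includes `a = b`; hence `L + 1` in front
of `N`. -/
theorem torusBraid_linkCoeff (p q : ℕ) (x y : Fin q × Fin (p - 1)) :
    (torusBraid p q).linkCoeff (torusBraidIndex p q x) (torusBraidIndex p q y) =
      torusLinkMatrix q (p - 1) x y := by
  obtain ⟨a, i⟩ := x
  obtain ⟨b, j⟩ := y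
  have hs : (torusBraid p q).sign (torusBraidIndex p q (a, i)) = 1 := rfl
  simp only [BraidWord.linkCoeff, torusBraidIndex_lt, torusBraid_gen,
    EmbeddingLike.apply_eq_iff_eq, hs, torusLinkMatrix, lowerOnes, subdiagOnes, of_apply,
    Matrix.one_apply, Prod.mk.injEq, if_true]
  simp only [Fin.lt_def, Fin.ext_iff]
  split_ifs <;> first | (exfalso; omega) | simp

/-! ### Diagonalization of the hermitized Seifert form of a torus braid -/

namespace Matrix

variable {ι κ : Type*} [Fintype ι] [Fintype κ] [DecidableEq ι]

/-- Here `E` embeds the cycles in the chains, and `P` holds coordinates of orthogonal vectors. The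
nonsingular Gram matrix forces `P` to be invertible, so no determinant has to be computed. -/
theorem hasSignature_of_orthogonal {A : Matrix κ κ ℂ} {E : Matrix κ ι ℂ} {P : Matrix ι ι ℂ}
    {g d : ι → ℝ} (hg : ∀ i, g i ≠ 0)
    (hort : (E * P)ᴴ * (E * P) = diagonal (fun i => (g i : ℂ)))
    (hdiag : (E * P)ᴴ * A * (E * P) = diagonal (fun i => (d i : ℂ))) :
    (Eᴴ * A * E).HasSignature (∑ i, (SignType.sign (d i) : ℤ)) := by
  refine ⟨P, d, ?_, ?_, rfl⟩
  · have h1 : (Pᴴ * (Eᴴ * E)).det * P.det = ∏ i, (g i : ℂ) := by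
      rw [← det_mul, ← det_diagonal, ← hort, conjTranspose_mul]
      simp only [Matrix.mul_assoc]
    rw [isUnit_iff_ne_zero]
    intro h0
    rw [h0, mul_zero] at h1
    exact Finset.prod_ne_zero_iff.2 (fun i _ => Complex.ofReal_ne_zero.2 (hg i)) h1.symm
  · rw [← hdiag, conjTranspose_mul]
    simp only [Matrix.mul_assoc]

end Matrix

/-- The form of a Kronecker product factors on pure tensors. -/
theorem sum_sum_mul_mul_prod {ι κ R : Type*} [Fintype ι] [Fintype κ] [CommRing R]
    (f f' : ι → R) (g g' : κ → R) (A : Matrix ι ι R) (B : Matrix κ κ R) :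
    ∑ x : ι × κ, ∑ y : ι × κ, (f x.1 * g x.2) * (A x.1 y.1 * B x.2 y.2) * (f' y.1 * g' y.2) =
      (∑ a, ∑ b, f a * A a b * f' b) * (∑ i, ∑ l, g i * B i l * g' l) := by
  rw [Finset.sum_mul_sum, Fintype.sum_prod_type]
  refine Finset.sum_congr rfl fun a _ => Finset.sum_congr rfl fun i _ => ?_
  rw [Finset.sum_mul_sum, Fintype.sum_prod_type]
  exact Finset.sum_congr rfl fun b _ => Finset.sum_congr rfl fun l _ => by ring

/-! ### Roots of unity and the triangular matrix of ones -/

section RootsOfUnity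

theorem sum_fin_pow_eq_zero {q : ℕ} {x : ℂ} (hx : x ^ q = 1) (hx1 : x ≠ 1) :
    ∑ a : Fin q, x ^ (a : ℕ) = 0 := by
  rw [Fin.sum_univ_eq_sum_range (fun a => x ^ a), geom_sum_eq hx1, hx, sub_self, zero_div]

theorem sum_lowerOnes_mul_pow {q : ℕ} {y : ℂ} (hy1 : y ≠ 1) (a : Fin q) :
    ∑ b, lowerOnes ℂ q a b * y ^ (b : ℕ) = (y ^ (a : ℕ) - 1) / (y - 1) := by
  rw [← geom_sum_eq hy1, ← Fin.sum_univ_eq_sum_range]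
  have h : (a : ℕ) ≤ q := a.isLt.le
  have := Fin.sum_univ_eq_sum_range (fun b => if b < (a : ℕ) then y ^ b else 0) q
  simp only [lowerOnes, of_apply, ite_mul, one_mul, zero_mul, Fin.lt_def]
  rw [this, Fin.sum_univ_eq_sum_range (fun b => y ^ b), ← Finset.sum_filter]
  congr 1
  ext b
  simp only [Finset.mem_filter, Finset.mem_range]
  omega

variable {q : ℕ} {x y : ℂ}

/-- `L` sends the powers of `y` to `(y ^ a - 1) / (y - 1)`, and the constant part dies against the
powers of `x`, whose sum is zero. So `L` acts like the scalar `1 / (y - 1)`. -/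
theorem sum_conj_pow_mul_lowerOnes_mul_pow (hx : x ^ q = 1) (hx1 : x ≠ 1) (hy1 : y ≠ 1) :
    ∑ a : Fin q, ∑ b : Fin q, conj (x ^ (a : ℕ)) * lowerOnes ℂ q a b * y ^ (b : ℕ) =
      (∑ a : Fin q, conj (x ^ (a : ℕ)) * y ^ (a : ℕ)) / (y - 1) := by
  have h0 : ∑ a : Fin q, conj (x ^ (a : ℕ)) = 0 := by
    rw [← map_sum, sum_fin_pow_eq_zero hx hx1, map_zero]
  simp only [mul_assoc, ← Finset.mul_sum, sum_lowerOnes_mul_pow hy1]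
  simp only [mul_div_assoc', ← Finset.sum_div, mul_sub, mul_one, Finset.sum_sub_distrib, h0,
    sub_zero]

theorem conj_mul_self_of_pow_eq_one (hq : q ≠ 0) (hx : x ^ q = 1) : conj x * x = 1 := by
  rw [← Complex.normSq_eq_conj_mul_self, Complex.normSq_eq_norm_sq,
    Complex.norm_eq_one_of_pow_eq_one hx hq]
  simp

theorem sum_conj_pow_mul_pow_self (hq : q ≠ 0) (hx : x ^ q = 1) :
    ∑ a : Fin q, conj (x ^ (a : ℕ)) * x ^ (a : ℕ) = q := by
  simp only [map_pow, ← mul_pow, conj_mul_self_of_pow_eq_one hq hx]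
  simp

theorem sum_conj_pow_mul_pow_of_ne (hq : q ≠ 0) (hx : x ^ q = 1) (hy : y ^ q = 1) (hxy : x ≠ y) :
    ∑ a : Fin q, conj (x ^ (a : ℕ)) * y ^ (a : ℕ) = 0 := by
  simp only [map_pow, ← mul_pow]
  refine sum_fin_pow_eq_zero ?_ fun h => hxy ?_
  · rw [mul_pow, ← map_pow, hx, hy, map_one, one_mul]
  · have h1 := conj_mul_self_of_pow_eq_one hq hx
    have h2 : conj x ≠ 0 := left_ne_zero_of_mul_eq_one h1
    exact mul_left_cancel₀ h2 (h1.trans h.symm)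

end RootsOfUnity

/-! ### Sine eigenvectors of a path -/

section Sines

/-- The entries of the eigenvectors of the adjacency matrix of a path. -/
noncomputable def pathSine (m : ℕ) (j i : Fin m) : ℝ :=
  Real.sin ((i + 1) * (Real.pi * ((j + 1) / (m + 1))))

variable {m : ℕ}

/-- At the first vertex the missing neighbour contributes `sin 0 = 0`, so the shift formula needs no
exception. -/
theorem sum_subdiagOnes_mul_pathSine (j i : Fin m) :
    ∑ l, subdiagOnes ℝ m i l * pathSine m j l =
      Real.sin (i * (Real.pi * ((j + 1) / (m + 1)))) := by
  obtain ⟨i, hi⟩ := i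
  simp only [subdiagOnes, of_apply, ite_mul, one_mul, zero_mul]
  cases i with
  | zero => simp
  | succ i =>
    rw [Finset.sum_eq_single ⟨i, by omega⟩]
    · simp [pathSine]
    · intro l _ hl
      rw [if_neg]
      intro h
      exact hl (Fin.ext (by simpa using h.symm))
    · simp

theorem sum_subdiagOnes_mul_pathSine' (j i : Fin m) :
    ∑ l, subdiagOnes ℝ m l i * pathSine m j l =
      Real.sin ((i + 2) * (Real.pi * ((j + 1) / (m + 1)))) := by
  obtain ⟨i, hi⟩ := i
  simp only [subdiagOnes, of_apply, ite_mul, one_mul, zero_mul]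
  by_cases him : i + 1 < m
  · rw [Finset.sum_eq_single ⟨i + 1, him⟩]
    · simp [pathSine]
      ring_nf
    · intro l _ hl
      rw [if_neg]
      intro h
      exact hl (Fin.ext h)
    · simp
  · have hm : (m : ℝ) = i + 1 := by
      have : m = i + 1 := by omega
      exact_mod_cast this
    -- At the last vertex the missing neighbour has the angle `(j + 1)π`, whose sine is zero.
    have h0 : (i + 2 : ℝ) * (Real.pi * ((j + 1) / (m + 1))) = ((j + 1 : ℕ) : ℝ) * Real.pi := by
      have : (i + 1 + 1 : ℝ) ≠ 0 := by positivity
      rw [hm]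
      push_cast
      field_simp
      ring
    rw [h0, Real.sin_nat_mul_pi]
    refine Finset.sum_eq_zero fun l _ => ?_
    rw [if_neg]
    have := l.isLt
    omega

/-- `N + Nᵀ` is the adjacency matrix of the path, and `sin (x + θ) + sin (x - θ) = 2 cos θ sin x`
makes the sine vectors its eigenvectors. -/
theorem sum_pathSine_mul_subdiagOnes (j j' : Fin m) :
    (∑ i, ∑ l, pathSine m j i * subdiagOnes ℝ m i l * pathSine m j' l) +
      (∑ i, ∑ l, pathSine m j' i * subdiagOnes ℝ m i l * pathSine m j l) =
    2 * Real.cos (Real.pi * ((j' + 1) / (m + 1))) * ∑ i, pathSine m j i * pathSine m j' i := by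
  rw [Finset.sum_comm (f := fun i l => pathSine m j' i * subdiagOnes ℝ m i l * pathSine m j l),
    ← Finset.sum_add_distrib, Finset.mul_sum]
  refine Finset.sum_congr rfl fun i _ => ?_
  have h1 : ∑ l, pathSine m j i * subdiagOnes ℝ m i l * pathSine m j' l =
      pathSine m j i * Real.sin (i * (Real.pi * ((j' + 1) / (m + 1)))) := by
    rw [← sum_subdiagOnes_mul_pathSine, Finset.mul_sum]
    exact Finset.sum_congr rfl fun l _ => by ring
  have h2 : ∑ l, pathSine m j' l * subdiagOnes ℝ m l i * pathSine m j i =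
      pathSine m j i * Real.sin ((i + 2) * (Real.pi * ((j' + 1) / (m + 1)))) := by
    rw [← sum_subdiagOnes_mul_pathSine', Finset.mul_sum]
    exact Finset.sum_congr rfl fun l _ => by ring
  rw [h1, h2]
  set θ := Real.pi * (((j' : ℕ) + 1 : ℝ) / (m + 1)) with hθ
  have h3 : (i + 2 : ℝ) * θ = (i + 1) * θ + θ := by ring
  have h4 : (i : ℝ) * θ = (i + 1) * θ - θ := by ring
  have h5 : pathSine m j' i = Real.sin ((i + 1) * θ) := rfl
  rw [h3, h4, Real.sin_add, Real.sin_sub, h5]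
  ring

theorem pathAngle_mem (j : Fin m) :
    Real.pi * ((j + 1) / (m + 1)) ∈ Set.Ioo 0 Real.pi := by
  have hj : (j : ℝ) < m := by exact_mod_cast j.isLt
  have hm : (0 : ℝ) < m + 1 := by positivity
  constructor
  · positivity
  · have : ((j : ℝ) + 1) / (m + 1) < 1 := by rw [div_lt_one hm]; linarith
    nlinarith [Real.pi_pos]

/-- Eigenvectors of a symmetric matrix for distinct eigenvalues are orthogonal; the eigenvalues
differ because cosine is injective on `[0, π]`. -/
theorem sum_pathSine_mul_pathSine_of_ne {j j' : Fin m} (h : j ≠ j') :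
    ∑ i, pathSine m j i * pathSine m j' i = 0 := by
  have h1 := sum_pathSine_mul_subdiagOnes j j'
  have h2 := sum_pathSine_mul_subdiagOnes j' j
  rw [add_comm, h1] at h2
  simp only [mul_comm (pathSine m j' _)] at h2
  have h3 : Real.cos (Real.pi * ((j + 1) / (m + 1))) ≠
      Real.cos (Real.pi * ((j' + 1) / (m + 1))) := by
    intro hc
    have h4 := Real.injOn_cos (Set.Ioo_subset_Icc_self (pathAngle_mem j))
      (Set.Ioo_subset_Icc_self (pathAngle_mem j')) hc
    have hm : (m : ℝ) + 1 ≠ 0 := by positivity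
    have h5 := mul_left_cancel₀ Real.pi_ne_zero h4
    rw [div_left_inj' hm, add_left_inj] at h5
    exact h (Fin.ext (by exact_mod_cast h5))
  have h5 : (Real.cos (Real.pi * ((j + 1) / (m + 1))) - Real.cos (Real.pi * ((j' + 1) / (m + 1)))) *
      ∑ i, pathSine m j i * pathSine m j' i = 0 := by linarith
  exact (mul_eq_zero.1 h5).resolve_left (sub_ne_zero.2 h3)

theorem sum_pathSine_mul_self_pos (j : Fin m) : 0 < ∑ i, pathSine m j i * pathSine m j i := by
  have hm : 0 < m := j.pos
  refine Finset.sum_pos' (fun i _ => mul_self_nonneg _) ⟨⟨0, hm⟩, Finset.mem_univ _, ?_⟩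
  refine mul_self_pos.2 (ne_of_gt ?_)
  have := pathAngle_mem j
  simpa [pathSine] using Real.sin_pos_of_pos_of_lt_pi this.1 this.2

end Sines

/-! ### Half-angle formulas for phases -/

section Phases

theorem exp_two_mul_I_sub_one (A : ℝ) :
    Complex.exp (2 * A * Complex.I) - 1 =
      2 * Complex.I * Real.sin A * Complex.exp (A * Complex.I) := by
  rw [Complex.ofReal_sin, Complex.sin]
  have h1 : Complex.exp (2 * A * Complex.I) =
      Complex.exp (A * Complex.I) * Complex.exp (A * Complex.I) := by
    rw [← Complex.exp_add]; ring_nf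
  have h2 : Complex.exp (-A * Complex.I) * Complex.exp (A * Complex.I) = 1 := by
    rw [← Complex.exp_add]; simp
  rw [h1]
  linear_combination (-Complex.exp (-A * Complex.I) * Complex.exp (A * Complex.I) +
    Complex.exp (A * Complex.I) ^ 2) * Complex.I_sq + h2

/-- With `A = πt` and `B` half the argument of a root of unity `ζ`, this splits `(1 - ω) / (ζ - 1)`
into a real factor and a phase. -/
theorem one_sub_exp_div_exp_sub_one (A : ℝ) {B : ℝ} (hB : Real.sin B ≠ 0) :
    (1 - Complex.exp (2 * A * Complex.I)) / (Complex.exp (2 * B * Complex.I) - 1) =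
      -((Real.sin A / Real.sin B : ℝ) : ℂ) * Complex.exp ((A - B : ℝ) * Complex.I) := by
  have h1 := exp_two_mul_I_sub_one A
  have h2 := exp_two_mul_I_sub_one B
  have hB' : ((Real.sin B : ℝ) : ℂ) ≠ 0 := Complex.ofReal_ne_zero.2 hB
  have h3 : Complex.exp (2 * B * Complex.I) - 1 ≠ 0 := by
    rw [h2]
    simp only [ne_eq, mul_eq_zero, hB', Complex.exp_ne_zero, Complex.I_ne_zero, or_false]
    norm_num
  have h4 : Complex.exp (A * Complex.I) =
      Complex.exp ((A - B : ℝ) * Complex.I) * Complex.exp (B * Complex.I) := by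
    rw [← Complex.exp_add]; push_cast; ring_nf
  rw [div_eq_iff h3, h2, ← neg_sub, h1, h4, Complex.ofReal_div]
  field_simp

end Phases

/-! ### The signature of the Seifert form of a torus braid -/

section TorusForm

variable {r m : ℕ}

/-- The root of unity `exp (2πi(k+1)/(r+1))`. -/
noncomputable def torusRoot (r : ℕ) (k : Fin r) : ℂ :=
  Complex.exp (2 * (Real.pi * ((k + 1) / (r + 1)) : ℝ) * Complex.I)

theorem torusRoot_pow (k : Fin r) : torusRoot r k ^ (r + 1) = 1 := by
  rw [torusRoot, ← Complex.exp_nat_mul, Complex.exp_eq_one_iff]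
  refine ⟨(k + 1 : ℕ), ?_⟩
  have : (r : ℂ) + 1 ≠ 0 := by exact_mod_cast Nat.succ_ne_zero r
  push_cast
  field_simp

theorem sin_torusAngle_pos (k : Fin r) : 0 < Real.sin (Real.pi * ((k + 1) / (r + 1))) :=
  Real.sin_pos_of_pos_of_lt_pi (pathAngle_mem k).1 (pathAngle_mem k).2

theorem torusRoot_ne_one (k : Fin r) : torusRoot r k ≠ 1 := by
  rw [← sub_ne_zero, torusRoot, exp_two_mul_I_sub_one]
  have := Complex.ofReal_ne_zero.2 (sin_torusAngle_pos k).ne'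
  simp only [ne_eq, mul_eq_zero, this, Complex.exp_ne_zero, Complex.I_ne_zero, or_false]
  norm_num

theorem torusRoot_injective : Function.Injective (torusRoot r) := by
  intro k l h
  set A := Real.pi * (((k : ℕ) + 1 : ℝ) / (r + 1)) with hA
  set B := Real.pi * (((l : ℕ) + 1 : ℝ) / (r + 1)) with hB
  have h1 : Complex.exp (2 * (A - B : ℝ) * Complex.I) = 1 := by
    have : (2 * (A - B : ℝ) * Complex.I : ℂ) = 2 * A * Complex.I - 2 * B * Complex.I := by
      push_cast; ring
    rw [this, Complex.exp_sub, div_eq_one_iff_eq (Complex.exp_ne_zero _)]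
    exact h
  rw [← sub_eq_zero, exp_two_mul_I_sub_one] at h1
  have h2 : Real.sin (A - B) = 0 := by
    simp only [mul_eq_zero, Complex.exp_ne_zero, Complex.I_ne_zero, or_false,
      Complex.ofReal_eq_zero] at h1
    simpa using h1
  have hA' := pathAngle_mem k
  have hB' := pathAngle_mem l
  rw [← hA] at hA'
  rw [← hB] at hB'
  have h3 := (Real.sin_eq_zero_iff_of_lt_of_lt (by linarith [hA'.1, hB'.2])
    (by linarith [hA'.2, hB'.1])).1 h2
  have hr : (r : ℝ) + 1 ≠ 0 := by positivity
  have h4 := mul_left_cancel₀ Real.pi_ne_zero (hA.symm.trans ((sub_eq_zero.1 h3).trans hB))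
  rw [div_left_inj' hr, add_left_inj] at h4
  exact Fin.ext (by exact_mod_cast h4)

/-- The matrix whose columns diagonalize the Seifert form of a torus braid at `exp (2πit)`. -/
noncomputable def torusEigenvectors (t : ℝ) (r m : ℕ) :
    Matrix (Fin (r + 1) × Fin m) (Fin r × Fin m) ℂ :=
  of fun x c => torusRoot r c.1 ^ (x.1 : ℕ) *
    (Complex.exp ((Real.pi * t + Real.pi * ((c.1 + 1) / (r + 1)) : ℝ) * Complex.I) ^ (x.2 : ℕ) *
      pathSine m c.2 x.2)

theorem conj_exp_ofReal_mul_I_mul_self (A : ℝ) :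
    conj (Complex.exp (A * Complex.I)) * Complex.exp (A * Complex.I) = 1 := by
  rw [← Complex.exp_conj, ← Complex.exp_add]
  simp

theorem sum_conj_phase_mul_one (A : ℝ) (j j' : Fin m) :
    ∑ i : Fin m, ∑ l : Fin m, conj (Complex.exp (A * Complex.I) ^ (i : ℕ) * pathSine m j i) *
      (1 : Matrix (Fin m) (Fin m) ℂ) i l * (Complex.exp (A * Complex.I) ^ (l : ℕ) *
        pathSine m j' l) = ((∑ i, pathSine m j i * pathSine m j' i : ℝ) : ℂ) := by
  push_cast
  refine Finset.sum_congr rfl fun i _ => ?_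
  simp only [Matrix.one_apply, mul_ite, mul_one, mul_zero, ite_mul, zero_mul, Finset.sum_ite_eq,
    Finset.mem_univ, if_true, map_mul, map_pow, Complex.conj_ofReal]
  rw [mul_mul_mul_comm, ← mul_pow, conj_exp_ofReal_mul_I_mul_self, one_pow, one_mul]

/-- Twisting by powers of a phase `u` multiplies `N` by `conj u`. The phase in `torusEigenvectors`
is chosen so that this cancels the phase of the coefficient of `N`. -/
theorem sum_conj_phase_mul_subdiagOnes (A : ℝ) (j j' : Fin m) :
    ∑ i : Fin m, ∑ l : Fin m, conj (Complex.exp (A * Complex.I) ^ (i : ℕ) * pathSine m j i) *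
      subdiagOnes ℂ m i l * (Complex.exp (A * Complex.I) ^ (l : ℕ) * pathSine m j' l) =
    conj (Complex.exp (A * Complex.I)) *
      ((∑ i, ∑ l, pathSine m j i * subdiagOnes ℝ m i l * pathSine m j' l : ℝ) : ℂ) := by
  push_cast
  rw [Finset.mul_sum]
  refine Finset.sum_congr rfl fun i _ => ?_
  rw [Finset.mul_sum]
  refine Finset.sum_congr rfl fun l _ => ?_
  by_cases h : (i : ℕ) = l + 1
  · simp only [subdiagOnes, of_apply, h, if_true, map_mul, map_pow, Complex.conj_ofReal,
      Complex.ofReal_one, mul_one, pow_succ]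
    have h1 : conj (Complex.exp (A * Complex.I)) ^ (l : ℕ) * Complex.exp (A * Complex.I) ^ (l : ℕ)
        = 1 := by
      rw [← mul_pow, conj_exp_ofReal_mul_I_mul_self, one_pow]
    linear_combination (conj (Complex.exp (A * Complex.I)) * pathSine m j i * pathSine m j' l) * h1
  · simp [subdiagOnes, h]

/-- Different roots of unity give orthogonal columns. For equal roots the phases agree and cancel,
and the orthogonality of the sine vectors remains. -/
theorem torusEigenvectors_gram (t : ℝ) :
    (torusEigenvectors t r m)ᴴ * torusEigenvectors t r m =
      diagonal (fun c => (((r + 1) * ∑ i, pathSine m c.2 i * pathSine m c.2 i : ℝ) : ℂ)) := by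
  ext ⟨k, j⟩ ⟨k', j'⟩
  have h1 : ((torusEigenvectors t r m)ᴴ * torusEigenvectors t r m) (k, j) (k', j') =
      (∑ a : Fin (r + 1), conj (torusRoot r k ^ (a : ℕ)) * torusRoot r k' ^ (a : ℕ)) *
      ∑ i : Fin m, conj (Complex.exp ((Real.pi * t + Real.pi * ((k + 1) / (r + 1)) : ℝ) *
        Complex.I) ^ (i : ℕ) * pathSine m j i) *
        (Complex.exp ((Real.pi * t + Real.pi * ((k' + 1) / (r + 1)) : ℝ) *
        Complex.I) ^ (i : ℕ) * pathSine m j' i) := by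
    rw [Matrix.mul_apply, Finset.sum_mul_sum, Fintype.sum_prod_type]
    refine Finset.sum_congr rfl fun a _ => Finset.sum_congr rfl fun i _ => ?_
    simp only [conjTranspose_apply, torusEigenvectors, of_apply, star_mul', RCLike.star_def,
      map_mul]
    ring
  rw [h1]
  by_cases hk : k = k'
  · subst hk
    rw [sum_conj_pow_mul_pow_self (Nat.succ_ne_zero r) (torusRoot_pow k)]
    have h2 := sum_conj_phase_mul_one (Real.pi * t + Real.pi * ((k + 1) / (r + 1))) j j'
    simp only [Matrix.one_apply, mul_ite, mul_one, mul_zero, ite_mul, zero_mul, Finset.sum_ite_eq,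
      Finset.mem_univ, if_true] at h2
    rw [h2]
    by_cases hj : j = j'
    · subst hj
      simp
    · rw [sum_pathSine_mul_pathSine_of_ne hj, diagonal_apply_ne _ (by simpa using hj)]
      simp
  · rw [sum_conj_pow_mul_pow_of_ne (Nat.succ_ne_zero r) (torusRoot_pow k) (torusRoot_pow k')
      (torusRoot_injective.ne hk), zero_mul, diagonal_apply_ne _ (by simp [hk])]

theorem torusEigenvectors_linkMatrix (t : ℝ) (k k' : Fin r) (j j' : Fin m) :
    ((torusEigenvectors t r m)ᴴ * (torusLinkMatrix (r + 1) m).map (Int.cast : ℤ → ℂ) *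
      torusEigenvectors t r m) (k, j) (k', j') =
    if k = k' then (r + 1) * ((1 / (torusRoot r k - 1)) *
        ((∑ i, pathSine m j i * pathSine m j' i : ℝ) : ℂ) -
      (1 / (torusRoot r k - 1) + 1) * (conj (Complex.exp ((Real.pi * t +
          Real.pi * ((k + 1) / (r + 1)) : ℝ) * Complex.I)) *
        ((∑ i, ∑ l, pathSine m j i * subdiagOnes ℝ m i l * pathSine m j' l : ℝ) : ℂ)))
    else 0 := by
  set y : Fin r → Fin m → Fin m → ℂ := fun k j i =>
    Complex.exp ((Real.pi * t + Real.pi * ((k + 1) / (r + 1)) : ℝ) * Complex.I) ^ (i : ℕ) *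
      pathSine m j i with hy
  have h1 : ((torusEigenvectors t r m)ᴴ * (torusLinkMatrix (r + 1) m).map (Int.cast : ℤ → ℂ) *
      torusEigenvectors t r m) (k, j) (k', j') =
      (∑ a : Fin (r + 1), ∑ b : Fin (r + 1), conj (torusRoot r k ^ (a : ℕ)) *
        lowerOnes ℂ (r + 1) a b * torusRoot r k' ^ (b : ℕ)) *
      (∑ i, ∑ l, conj (y k j i) * (1 : Matrix (Fin m) (Fin m) ℂ) i l * y k' j' l) -
      (∑ a : Fin (r + 1), ∑ b : Fin (r + 1), conj (torusRoot r k ^ (a : ℕ)) *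
        (lowerOnes ℂ (r + 1) + 1) a b * torusRoot r k' ^ (b : ℕ)) *
      (∑ i, ∑ l, conj (y k j i) * subdiagOnes ℂ m i l * y k' j' l) := by
    rw [← sum_sum_mul_mul_prod (fun a : Fin (r + 1) => conj (torusRoot r k ^ (a : ℕ)))
        (fun b => torusRoot r k' ^ (b : ℕ)) (fun i => conj (y k j i)) (y k' j'),
      ← sum_sum_mul_mul_prod (fun a : Fin (r + 1) => conj (torusRoot r k ^ (a : ℕ)))
        (fun b => torusRoot r k' ^ (b : ℕ)) (fun i => conj (y k j i)) (y k' j'),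
      ← Finset.sum_sub_distrib, Matrix.mul_assoc, Matrix.mul_apply]
    refine Finset.sum_congr rfl fun x _ => ?_
    rw [Matrix.mul_apply, Finset.mul_sum, ← Finset.sum_sub_distrib]
    refine Finset.sum_congr rfl fun z _ => ?_
    have h2 : ((torusLinkMatrix (r + 1) m).map (Int.cast : ℤ → ℂ)) x z =
        lowerOnes ℂ (r + 1) x.1 z.1 * (1 : Matrix (Fin m) (Fin m) ℂ) x.2 z.2 -
          (lowerOnes ℂ (r + 1) + 1) x.1 z.1 * subdiagOnes ℂ m x.2 z.2 := by
      simp [torusLinkMatrix, lowerOnes, subdiagOnes, Matrix.one_apply]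
    rw [h2]
    simp only [conjTranspose_apply, torusEigenvectors, of_apply, star_mul', RCLike.star_def, hy,
      map_mul]
    ring
  have h3 : ∑ a : Fin (r + 1), ∑ b : Fin (r + 1), conj (torusRoot r k ^ (a : ℕ)) *
        (lowerOnes ℂ (r + 1) + 1) a b * torusRoot r k' ^ (b : ℕ) =
      (∑ a : Fin (r + 1), ∑ b : Fin (r + 1), conj (torusRoot r k ^ (a : ℕ)) *
        lowerOnes ℂ (r + 1) a b * torusRoot r k' ^ (b : ℕ)) +
      ∑ a : Fin (r + 1), conj (torusRoot r k ^ (a : ℕ)) * torusRoot r k' ^ (a : ℕ) := by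
    simp [Matrix.add_apply, mul_add, add_mul, Finset.sum_add_distrib, Matrix.one_apply]
  rw [h1, h3, sum_conj_pow_mul_lowerOnes_mul_pow (torusRoot_pow k) (torusRoot_ne_one k)
    (torusRoot_ne_one k')]
  by_cases hk : k = k'
  · subst hk
    rw [if_pos rfl, sum_conj_pow_mul_pow_self (Nat.succ_ne_zero r) (torusRoot_pow k), hy,
      sum_conj_phase_mul_one, sum_conj_phase_mul_subdiagOnes]
    push_cast
    ring
  · rw [if_neg hk, sum_conj_pow_mul_pow_of_ne (Nat.succ_ne_zero r) (torusRoot_pow k)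
      (torusRoot_pow k') (torusRoot_injective.ne hk)]
    simp

theorem conjTranspose_mul_hermitize_mul {ι κ : Type*} [Fintype ι] (α : ℂ) (C : Matrix ι ι ℤ)
    (W : Matrix ι κ ℂ) :
    Wᴴ * hermitize α C * W = α • (Wᴴ * C.map (Int.cast : ℤ → ℂ) * W) +
      conj α • (Wᴴ * C.map (Int.cast : ℤ → ℂ) * W)ᴴ := by
  have h : (C.map (Int.cast : ℤ → ℂ))ᵀ = (C.map (Int.cast : ℤ → ℂ))ᴴ := by
    ext i j; simp
  rw [hermitize, h]
  simp only [conjTranspose_mul, conjTranspose_conjTranspose, Matrix.mul_add, Matrix.add_mul,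
    Matrix.mul_smul, Matrix.smul_mul, Matrix.mul_assoc]

/-- The diagonal entry that belongs to a column of `torusEigenvectors`. -/
noncomputable def torusEigenvalue (t : ℝ) (r m : ℕ) (c : Fin r × Fin m) : ℝ :=
  2 * (r + 1) * (Real.sin (Real.pi * t) / Real.sin (Real.pi * ((c.1 + 1) / (r + 1)))) *
    (∑ i, pathSine m c.2 i * pathSine m c.2 i) *
    (Real.cos (Real.pi * ((c.2 + 1) / (m + 1))) -
      Real.cos (Real.pi * t - Real.pi * ((c.1 + 1) / (r + 1))))

/-- With `A = πt`, `B = π(k + 1)/(r + 1)` and `ρ = sin A / sin B`, the coefficients of `1` and `N`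
are `-ρ v` and `ρ u`, where `v = e^{i(A - B)}` and `u = e^{i(A + B)}`. The twist removes `u`; adding
the adjoint yields `ρ` times `N + Nᵀ - 2 cos (A - B)` on the sine vectors. -/
theorem torusEigenvectors_diagonalize (t : ℝ) :
    (torusEigenvectors t r m)ᴴ *
        hermitize (1 - Complex.exp (2 * Real.pi * Complex.I * t)) (torusLinkMatrix (r + 1) m) *
        torusEigenvectors t r m =
      diagonal (fun c => (torusEigenvalue t r m c : ℂ)) := by
  rw [conjTranspose_mul_hermitize_mul]
  ext ⟨k, j⟩ ⟨k', j'⟩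
  rw [Matrix.add_apply, Matrix.smul_apply, Matrix.smul_apply, conjTranspose_apply,
    torusEigenvectors_linkMatrix, torusEigenvectors_linkMatrix]
  by_cases hk : k = k'
  swap
  · rw [if_neg hk, if_neg (Ne.symm hk), diagonal_apply_ne _ (by simp [hk])]
    simp
  subst hk
  rw [if_pos rfl, if_pos rfl]
  set B := Real.pi * (((k : ℕ) + 1 : ℝ) / (r + 1)) with hB
  set A := Real.pi * t with hA
  set α := 1 - Complex.exp (2 * Real.pi * Complex.I * t) with hα
  set u := Complex.exp ((A + B : ℝ) * Complex.I) with hu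
  set v := Complex.exp ((A - B : ℝ) * Complex.I) with hv
  have hsin : Real.sin B ≠ 0 := (sin_torusAngle_pos k).ne'
  set ρ := Real.sin A / Real.sin B with hρ
  have hα' : α = 1 - Complex.exp (2 * A * Complex.I) := by
    rw [hα, hA]; push_cast; ring_nf
  have hc : α * (1 / (torusRoot r k - 1)) = -(ρ : ℂ) * v := by
    rw [mul_one_div, hα', torusRoot, ← hB, one_sub_exp_div_exp_sub_one A hsin]
  have huv : v * torusRoot r k = u := by
    rw [hu, hv, torusRoot, ← hB, ← Complex.exp_add]
    push_cast; ring_nf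
  have hne : torusRoot r k - 1 ≠ 0 := sub_ne_zero.2 (torusRoot_ne_one k)
  have hc' : α * (1 / (torusRoot r k - 1) + 1) = -(ρ : ℂ) * u := by
    rw [← huv]
    have : 1 / (torusRoot r k - 1) + 1 = 1 / (torusRoot r k - 1) * torusRoot r k := by
      field_simp
      ring
    rw [this, ← mul_assoc, hc]
    ring
  have huu : conj u * u = 1 := conj_exp_ofReal_mul_I_mul_self _
  have hvv : v + conj v = 2 * (Real.cos (A - B) : ℂ) := by
    rw [hv, ← Complex.exp_conj, Complex.ofReal_cos, Complex.cos]
    simp only [map_mul, Complex.conj_ofReal, Complex.conj_I]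
    ring_nf
  have hs := sum_pathSine_mul_subdiagOnes j j'
  set ν := ∑ i, ∑ l, pathSine m j i * subdiagOnes ℝ m i l * pathSine m j' l
  set ν' := ∑ i, ∑ l, pathSine m j' i * subdiagOnes ℝ m i l * pathSine m j l
  have hg : ∑ i, pathSine m j' i * pathSine m j i = ∑ i, pathSine m j i * pathSine m j' i := by
    simp only [mul_comm]
  rw [hg]
  have hd : (diagonal (fun c => (torusEigenvalue t r m c : ℂ)) : Matrix _ _ ℂ) (k, j) (k, j') =
      ((2 * (r + 1) * ρ * (∑ i, pathSine m j i * pathSine m j' i) *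
        (Real.cos (Real.pi * ((j' + 1) / (m + 1))) - Real.cos (A - B)) : ℝ) : ℂ) := by
    by_cases hj : j = j'
    · subst hj
      rw [diagonal_apply_eq, torusEigenvalue]
    · rw [diagonal_apply_ne _ (by simpa using hj), sum_pathSine_mul_pathSine_of_ne hj]
      simp
  rw [hd]
  set g := ∑ i, pathSine m j i * pathSine m j' i
  have hs' : (ν + ν' : ℂ) = 2 * (Real.cos (Real.pi * ((j' + 1) / (m + 1))) : ℂ) * g := by
    exact_mod_cast hs
  have hcc := congrArg conj hc
  have hcc' := congrArg conj hc'
  simp only [map_mul, map_neg, map_add, Complex.conj_ofReal, map_one] at hcc hcc'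
  simp only [smul_eq_mul, RCLike.star_def, map_mul, map_sub, map_add, map_one, map_natCast,
    Complex.conj_ofReal, Complex.conj_conj]
  push_cast at hvv hs' ⊢
  linear_combination ((r : ℂ) + 1) * (g * hc - conj u * ν * hc' + g * hcc - u * ν' * hcc' -
    ρ * g * hvv + ρ * (ν + ν') * huu + ρ * hs')

theorem sign_cos_sub_cos {x y : ℝ} (hx : x ∈ Set.Icc 0 Real.pi) (hy : |y| ≤ Real.pi) :
    SignType.sign (Real.cos x - Real.cos y) = SignType.sign (|y| - x) := by
  rw [← Real.cos_abs y]
  have hy' : |y| ∈ Set.Icc 0 Real.pi := ⟨abs_nonneg y, hy⟩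
  rcases lt_trichotomy |y| x with h | h | h
  · rw [sign_neg (sub_neg.2 h), sign_neg (sub_neg.2 (Real.strictAntiOn_cos hy' hx h))]
  · rw [h]; simp
  · rw [sign_pos (sub_pos.2 h), sign_pos (sub_pos.2 (Real.strictAntiOn_cos hx hy' h))]

theorem sign_torusEigenvalue {t : ℝ} (ht : t ∈ Set.Ioo (0 : ℝ) 1) (c : Fin r × Fin m) :
    SignType.sign (torusEigenvalue t r m c) =
      SignType.sign (|t - (c.1 + 1) / (r + 1)| - (c.2 + 1) / (m + 1)) := by
  have hpi := Real.pi_pos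
  have hc1 := pathAngle_mem c.1
  have hc2 := pathAngle_mem c.2
  have h1 : 0 < 2 * ((r : ℝ) + 1) * (Real.sin (Real.pi * t) /
      Real.sin (Real.pi * ((c.1 + 1) / (r + 1)))) * (∑ i, pathSine m c.2 i * pathSine m c.2 i) := by
    have h2 : 0 < Real.sin (Real.pi * t) :=
      Real.sin_pos_of_pos_of_lt_pi (by nlinarith [ht.1]) (by nlinarith [ht.2])
    have h3 := sin_torusAngle_pos c.1
    exact mul_pos (mul_pos (by positivity) (div_pos h2 h3)) (sum_pathSine_mul_self_pos c.2)
  rw [torusEigenvalue, sign_mul, sign_pos h1, one_mul, sign_cos_sub_cos]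
  · rw [← mul_sub, abs_mul, abs_of_pos hpi, ← mul_sub, sign_mul, sign_pos hpi, one_mul]
  · exact Set.Ioo_subset_Icc_self hc2
  · rw [abs_le]
    constructor <;> nlinarith [ht.1, ht.2, hc1.1, hc1.2]

/-- The integral matrix of the basis `torusBraidBasis`. -/
def torusCycles (r m : ℕ) : Matrix (Fin (r + 1) × Fin m) (Fin r × Fin m) ℤ :=
  of fun x y => extendSumZero (Pi.single y 1) x

/-- The coordinates of the columns of `torusEigenvectors` in the basis `torusBraidBasis`. -/
noncomputable def torusEigencoords (t : ℝ) (r m : ℕ) :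
    Matrix (Fin r × Fin m) (Fin r × Fin m) ℂ :=
  of fun y c => torusEigenvectors t r m (y.1.succ, y.2) c

/-- Powers of a root of unity other than 1 sum to zero, so the columns are complex cycles and are
recovered from their entries outside the first block. -/
theorem torusCycles_mul (t : ℝ) :
    (torusCycles r m).map (Int.cast : ℤ → ℂ) * torusEigencoords t r m =
      torusEigenvectors t r m := by
  ext ⟨a, i⟩ c
  rw [Matrix.mul_apply]
  refine Fin.cases ?_ (fun a => ?_) a
  · have h0 : ∑ a, torusEigenvectors t r m (a, i) c = 0 := by
      simp only [torusEigenvectors, of_apply, ← Finset.sum_mul]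
      rw [sum_fin_pow_eq_zero (torusRoot_pow c.1) (torusRoot_ne_one c.1), zero_mul]
    rw [Fin.sum_univ_succ] at h0
    rw [eq_neg_of_add_eq_zero_left h0, Fintype.sum_prod_type, ← Finset.sum_neg_distrib]
    refine Finset.sum_congr rfl fun a _ => ?_
    rw [Finset.sum_eq_single i]
    · simp [torusCycles, torusEigencoords, extendSumZero, Pi.single_apply, Finset.filter_eq']
    · intro l _ hl
      simp [torusCycles, torusEigencoords, extendSumZero, Pi.single_apply, Ne.symm hl]
    · simp
  · rw [Finset.sum_eq_single (a, i)]
    · simp [torusCycles, torusEigencoords, extendSumZero]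
    · intro y _ hy
      simp [torusCycles, torusEigencoords, extendSumZero, Pi.single_apply, Ne.symm hy]
    · simp

theorem hasSignature_torusForm {t : ℝ} (ht : t ∈ Set.Ioo (0 : ℝ) 1) :
    (hermitize (1 - Complex.exp (2 * Real.pi * Complex.I * t))
      ((torusCycles r m)ᵀ * torusLinkMatrix (r + 1) m * torusCycles r m)).HasSignature
      (∑ c : Fin r × Fin m,
        (SignType.sign (|t - (c.1 + 1) / (r + 1)| - (c.2 + 1) / (m + 1)) : ℤ)) := by
  simp only [← sign_torusEigenvalue ht]
  have h := Matrix.hermitize_congr (1 - Complex.exp (2 * Real.pi * Complex.I * t))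
    (torusLinkMatrix (r + 1) m) (torusCycles r m)ᵀ
  simp only [transpose_transpose, transpose_map] at h
  rw [h]
  refine hasSignature_of_orthogonal
    (P := torusEigencoords t r m)
    (g := fun c => (r + 1) * ∑ i, pathSine m c.2 i * pathSine m c.2 i) (fun c => ?_) ?_ ?_
  · exact (mul_pos (by positivity) (sum_pathSine_mul_self_pos c.2)).ne'
  · rw [torusCycles_mul, torusEigenvectors_gram]
  · rw [torusCycles_mul, torusEigenvectors_diagonalize]

end TorusForm

theorem seifertForm_torusBraidBasis (p r : ℕ) :
    (of fun i j => (torusBraid p (r + 1)).seifertForm (torusBraidBasis p r i)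
      (torusBraidBasis p r j)) =
    (torusCycles r (p - 1))ᵀ * torusLinkMatrix (r + 1) (p - 1) * torusCycles r (p - 1) := by
  ext i j
  simp only [of_apply, BraidWord.seifertForm, Matrix.mul_apply, transpose_apply, Finset.sum_mul]
  rw [Finset.sum_comm, ← (torusBraidIndex p (r + 1)).sum_comp]
  refine Finset.sum_congr rfl fun y _ => ?_
  rw [← (torusBraidIndex p (r + 1)).sum_comp]
  refine Finset.sum_congr rfl fun x _ => ?_
  rw [torusBraid_linkCoeff, torusBraidBasis_apply, torusBraidBasis_apply]
  simp only [torusCycles, of_apply]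
  ring

/-- The Tristram–Levine signature of a torus knot as a sum of signs. -/
theorem tristramLevineSignature_torusBraid {p r : ℕ} {n : ℕ} {M : Matrix (Fin n) (Fin n) ℤ}
    (hM : IsSeifertMatrix (torusBraid p (r + 1)) M) {t : ℝ} (ht : t ∈ Set.Ioo (0 : ℝ) 1) :
    tristramLevineSignature M t = ∑ c : Fin r × Fin (p - 1),
      (SignType.sign (|t - (c.1 + 1) / (r + 1)| - (c.2 + 1) / ((p - 1 : ℕ) + 1)) : ℤ) := by
  apply tristramLevineSignature_eq_of_hasSignature
  refine hM.hasSignature ?_ (torusBraidBasis p r) ?_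
  · rw [sub_ne_zero, ne_comm]
    intro h
    have h1 : Complex.exp (2 * Real.pi * Complex.I * t) =
        Complex.exp (2 * (Real.pi * t : ℝ) * Complex.I) := by push_cast; ring_nf
    rw [h1, ← sub_eq_zero, exp_two_mul_I_sub_one] at h
    have h2 : 0 < Real.sin (Real.pi * t) :=
      Real.sin_pos_of_pos_of_lt_pi (by nlinarith [ht.1, Real.pi_pos])
        (by nlinarith [ht.2, Real.pi_pos])
    have h3 := Complex.ofReal_ne_zero.2 h2.ne'
    simp only [mul_eq_zero, h3, Complex.exp_ne_zero, Complex.I_ne_zero, or_false] at h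
    norm_num at h
  · rw [seifertForm_torusBraidBasis]
    exact hasSignature_torusForm ht

/-! ### Counting lattice points -/

section Lattice

variable {p r : ℕ}

/-- The positive combination `(j + 1) q + (k + 1) p` with `q = r + 1`. -/
def torusWeight (p r : ℕ) (c : Fin r × Fin (p - 1)) : ℕ :=
  (c.2 + 1) * (r + 1) + (c.1 + 1) * p

theorem add_le_torusWeight (c : Fin r × Fin (p - 1)) : p + (r + 1) ≤ torusWeight p r c := by
  rw [torusWeight]
  nlinarith [Nat.zero_le ((c.2 : ℕ) * (r + 1)), Nat.zero_le ((c.1 : ℕ) * p)]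

theorem not_dvd_torusWeight (hcop : p.Coprime (r + 1)) (c : Fin r × Fin (p - 1)) :
    ¬ p ∣ torusWeight p r c ∧ ¬ (r + 1) ∣ torusWeight p r c := by
  have h1 := c.1.isLt
  have h2 := c.2.isLt
  constructor
  · intro h
    rw [torusWeight, Nat.dvd_add_left (Dvd.intro_left _ rfl)] at h
    have := Nat.le_of_dvd (Nat.succ_pos _) (hcop.dvd_of_dvd_mul_right h)
    omega
  · intro h
    rw [torusWeight, Nat.dvd_add_right (Dvd.intro_left _ rfl)] at h
    have := Nat.le_of_dvd (Nat.succ_pos _) (hcop.symm.dvd_of_dvd_mul_right h)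
    omega

theorem torusWeight_injective (hcop : p.Coprime (r + 1)) :
    Function.Injective (torusWeight p r) := by
  rintro ⟨k, j⟩ ⟨k', j'⟩ h
  have hj := j.isLt
  have hj' := j'.isLt
  simp only [torusWeight] at h
  have h1 : ((j : ℕ) + 1) * (r + 1) ≡ (j' + 1) * (r + 1) [MOD p] := by
    have := congrArg (· % p) h
    simpa [Nat.ModEq] using this
  have h2 := (h1.cancel_right_of_coprime hcop).eq_of_lt_of_lt (by omega) (by omega)
  rw [h2, add_right_inj] at h
  have h3 := Nat.eq_of_mul_eq_mul_right (by omega : 0 < p) h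
  exact Prod.ext (Fin.ext (by simpa using h3)) (Fin.ext (by simpa using h2))

/-- After subtracting `p + q`, an equality would force `p` to divide an index below `p - 1`; that
index is then zero and the other one is `q`, out of range. -/
theorem torusWeight_ne (hcop : p.Coprime (r + 1)) (c : Fin r × Fin (p - 1)) :
    torusWeight p r c ≠ p * (r + 1) + (p + (r + 1)) := by
  intro h
  have h1 := c.1.isLt
  have h2 := c.2.isLt
  have h3 : (c.2 : ℕ) * (r + 1) + c.1 * p = p * (r + 1) := by
    rw [torusWeight] at h
    linarith
  have h4 : p ∣ (c.2 : ℕ) * (r + 1) :=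
    (Nat.dvd_add_left (Dvd.intro_left _ rfl)).1 (h3 ▸ Dvd.intro _ rfl)
  have h5 := Nat.eq_zero_of_dvd_of_lt (hcop.dvd_of_dvd_mul_right h4) (by omega)
  rw [h5, zero_mul, zero_add, mul_comm] at h3
  have := Nat.eq_of_mul_eq_mul_left (by omega : 0 < p) h3
  omega

/-- Write `x = kp + jq` with `0 ≤ j < p`. Then `j > 0` as `p ∤ x`, `k < 0` as `q ∤ x` and `x < p +
q`, and `k + q > 0` as `x ≥ 0`. So `pq + x = (k + q)p + jq` has both coefficients in range. -/
theorem exists_torusWeight_eq (hcop : p.Coprime (r + 1)) {x : ℕ} (hx : x < p + (r + 1))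
    (hxp : ¬ p ∣ x) (hxq : ¬ (r + 1) ∣ x) : ∃ c, torusWeight p r c = p * (r + 1) + x := by
  have hp : 0 < p := by
    rcases Nat.eq_zero_or_pos p with rfl | h
    · rw [Nat.coprime_zero_left] at hcop
      exact absurd (by rw [hcop]; exact one_dvd x) hxq
    · exact h
  have hbez : (x : ℤ) = (x * p.gcdA (r + 1)) * p + (x * p.gcdB (r + 1)) * ((r + 1 : ℕ) : ℤ) := by
    have := Nat.gcd_eq_gcd_ab p (r + 1)
    rw [hcop.gcd_eq_one] at this
    linear_combination (x : ℤ) * this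
  set a : ℤ := x * p.gcdA (r + 1)
  set b : ℤ := x * p.gcdB (r + 1)
  set q : ℤ := ((r + 1 : ℕ) : ℤ) with hq
  have hp' : (0 : ℤ) < p := by exact_mod_cast hp
  have hq' : 0 < q := by rw [hq]; positivity
  have hj0 := Int.emod_nonneg b hp'.ne'
  have hj1 := Int.emod_lt_of_pos b hp'
  have hdm := Int.emod_add_mul_ediv b p
  set j := b % p
  set k := a + q * (b / p) with hk
  have hjk : (x : ℤ) = k * p + j * q := by
    rw [hk]
    linear_combination hbez - q * hdm
  have hjpos : 0 < j := by
    refine lt_of_le_of_ne hj0 fun h => hxp ?_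
    rw [← h, zero_mul, add_zero] at hjk
    exact Int.natCast_dvd_natCast.1 (hjk ▸ Dvd.intro_left _ rfl)
  have hx' : (x : ℤ) < p + q := by rw [hq]; exact_mod_cast hx
  have hk0 : k < 0 := by
    by_contra! hk0
    rcases hk0.eq_or_lt with h | h
    · rw [← h, zero_mul, zero_add] at hjk
      exact hxq (Int.natCast_dvd_natCast.1 (hjk ▸ Dvd.intro_left _ rfl))
    · nlinarith
  have hkq : 0 < k + q := by
    by_contra! h
    nlinarith
  refine ⟨⟨⟨(k + q - 1).toNat, by omega⟩, ⟨(j - 1).toNat, by omega⟩⟩, ?_⟩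
  have h1 : (((k + q - 1).toNat : ℕ) : ℤ) = k + q - 1 := Int.toNat_of_nonneg (by omega)
  have h2 : (((j - 1).toNat : ℕ) : ℤ) = j - 1 := Int.toNat_of_nonneg (by omega)
  zify [torusWeight]
  rw [h1, h2, hjk]
  push_cast at hq
  rw [← hq]
  ring

theorem card_torusWeight (hcop : p.Coprime (r + 1)) {l : ℕ} (hl : l < p + (r + 1)) :
    (Finset.univ.filter fun c => p * (r + 1) < torusWeight p r c ∧
      torusWeight p r c ≤ p * (r + 1) + l).card =
    ((Finset.Ioc 0 l).filter fun x => ¬ p ∣ x ∧ ¬ (r + 1) ∣ x).card := by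
  refine Finset.card_bij (fun c _ => torusWeight p r c - p * (r + 1)) ?_ ?_ ?_
  · intro c hc
    simp only [Finset.mem_filter, Finset.mem_univ, true_and, Finset.mem_Ioc] at hc ⊢
    refine ⟨by omega, fun h => ?_, fun h => ?_⟩
    · refine (not_dvd_torusWeight hcop c).1 ?_
      rw [← Nat.sub_add_cancel hc.1.le]
      exact dvd_add h (Dvd.intro _ rfl)
    · refine (not_dvd_torusWeight hcop c).2 ?_
      rw [← Nat.sub_add_cancel hc.1.le]
      exact dvd_add h (Dvd.intro_left _ rfl)
  · intro c hc c' hc' h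
    simp only [Finset.mem_filter, Finset.mem_univ, true_and] at hc hc'
    exact torusWeight_injective hcop (by omega)
  · intro x hx
    simp only [Finset.mem_filter, Finset.mem_Ioc] at hx
    obtain ⟨c, hc⟩ := exists_torusWeight_eq hcop (by omega) hx.2.1 hx.2.2
    refine ⟨c, ?_, by omega⟩
    simp only [Finset.mem_filter, Finset.mem_univ, true_and]
    omega

theorem add_lt_mul_of_lt {q : ℕ} (hp : 2 ≤ p) (hpq : p < q) : p + q < p * q := by
  nlinarith

/-- No positive number up to `l` is divisible by both, since `l < p + q < pq`; so the two counts of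
multiples are simply subtracted. -/
theorem card_not_dvd (hp : 2 ≤ p) {q : ℕ} (hpq : p < q) (hcop : p.Coprime q) {l : ℕ}
    (hl : l < p + q) :
    ((((Finset.Ioc 0 l).filter fun x => ¬ p ∣ x ∧ ¬ q ∣ x).card : ℕ) : ℤ) =
      l - (l / q : ℕ) - (l / p : ℕ) := by
  have h1 := Finset.card_filter_add_card_filter_not (s := Finset.Ioc 0 l) (fun x => p ∣ x ∨ q ∣ x)
  have h2 : Disjoint ((Finset.Ioc 0 l).filter fun x => p ∣ x)
      ((Finset.Ioc 0 l).filter fun x => q ∣ x) := by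
    rw [Finset.disjoint_filter]
    intro x hx h h'
    rw [Finset.mem_Ioc] at hx
    have := Nat.le_of_dvd hx.1 (hcop.mul_dvd_of_dvd_of_dvd h h')
    have := add_lt_mul_of_lt hp hpq
    omega
  rw [Finset.filter_or, Finset.card_union_of_disjoint h2, Nat.Ioc_filter_dvd_card_eq_div,
    Nat.Ioc_filter_dvd_card_eq_div, Nat.card_Ioc] at h1
  simp only [not_or] at h1
  omega

end Lattice

/-! ### Sums of signs -/

section Signs

/-- As a function of `x`, the left side steps down at `-y` and up at `y`; with `sign 0 = 0` the
identity holds at the steps too. -/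
theorem sign_abs_sub {x y : ℝ} (hy : 0 < y) :
    (SignType.sign (|x| - y) : ℤ) = 1 + SignType.sign (x - y) - SignType.sign (x + y) := by
  rcases lt_trichotomy x y with h | h | h
  · rw [sign_neg (sub_neg.2 h)]
    rcases lt_trichotomy x (-y) with h' | h' | h'
    · rw [abs_of_neg (by linarith), sign_pos (by linarith), sign_neg (by linarith)]; rfl
    · rw [h', abs_neg, abs_of_pos hy, sub_self, neg_add_cancel, sign_zero]; rfl
    · rw [sign_neg (sub_neg.2 (abs_lt.2 ⟨h', h⟩)), sign_pos (by linarith)]; rfl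
  · rw [h, abs_of_pos hy, sub_self, sign_zero, sign_pos (by linarith : 0 < y + y)]; rfl
  · rw [abs_of_pos (hy.trans h), sign_pos (by linarith), sign_pos (by linarith)]; rfl

theorem intCast_sign_mono {x y : ℝ} (h : x ≤ y) :
    (SignType.sign x : ℤ) ≤ SignType.sign y := by
  have h1 := SignType.sign.monotone h
  generalize SignType.sign x = a at *
  generalize SignType.sign y = b at *
  revert a b
  decide

variable {p r : ℕ}

/-- The sum of the signs of `T + pq - v` over the weights `v`. -/
noncomputable def torusSignSum (p r : ℕ) (T : ℝ) : ℤ :=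
  ∑ c, (SignType.sign (T + p * (r + 1) - torusWeight p r c) : ℤ)

theorem torusSignSum_monotone : Monotone (torusSignSum p r) := fun S T h =>
  Finset.sum_le_sum fun c _ => intCast_sign_mono (by linarith)

/-- Reversing both indices sends a weight `v` to `2pq - v`, so the sum equals its own negative. -/
theorem torusSignSum_zero (hp : 1 ≤ p) : torusSignSum p r 0 = 0 := by
  have h : torusSignSum p r 0 = -torusSignSum p r 0 := by
    have h1 : ∀ c : Fin r × Fin (p - 1),
        (torusWeight p r (Fin.rev c.1, Fin.rev c.2) : ℝ) =
          2 * (p * (r + 1)) - torusWeight p r c := by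
      intro c
      have h2 : ((Fin.rev c.1 : ℕ) : ℝ) = r - (c.1 + 1) := by
        rw [Fin.val_rev, Nat.cast_sub c.1.isLt]; push_cast; ring
      have h3 : ((Fin.rev c.2 : ℕ) : ℝ) = p - 1 - (c.2 + 1) := by
        rw [Fin.val_rev, Nat.cast_sub c.2.isLt, Nat.cast_sub hp]; push_cast; ring
      simp only [torusWeight]
      push_cast
      rw [h2, h3]
      ring
    conv_lhs => rw [torusSignSum, ← (Equiv.prodCongr Fin.revPerm Fin.revPerm).sum_comp]
    rw [torusSignSum, ← Finset.sum_neg_distrib]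
    refine Finset.sum_congr rfl fun c _ => ?_
    have h4 := h1 c
    simp only [Equiv.prodCongr_apply, Prod.map, Fin.revPerm_apply]
    rw [h4]
    have h5 : (0 + p * (r + 1) - (2 * (p * (r + 1)) - torusWeight p r c) : ℝ) =
        -(0 + p * (r + 1) - torusWeight p r c) := by ring
    rw [h5, Left.sign_neg, SignType.coe_neg]
  omega

/-- Compared with `T = 0`, only the weights in `(pq, pq + l]` change sign, from -1 to 1. The number
`pq` itself is not a weight. -/
theorem torusSignSum_eq (hp : 1 ≤ p) (hcop : p.Coprime (r + 1)) {l : ℕ} {T : ℝ}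
    (hT : T ∈ Set.Ioo (l : ℝ) (l + 1)) :
    torusSignSum p r T = 2 * (Finset.univ.filter fun c => p * (r + 1) < torusWeight p r c ∧
      torusWeight p r c ≤ p * (r + 1) + l).card := by
  rw [← sub_zero (torusSignSum p r T), ← torusSignSum_zero hp (r := r), torusSignSum, torusSignSum,
    ← Finset.sum_sub_distrib, Finset.card_filter]
  push_cast
  rw [Finset.mul_sum]
  refine Finset.sum_congr rfl fun c _ => ?_
  have h0 : torusWeight p r c ≠ p * (r + 1) := fun h =>
    (not_dvd_torusWeight hcop c).1 (h ▸ Dvd.intro _ rfl)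
  have hl : (0 : ℝ) ≤ l := Nat.cast_nonneg l
  obtain ⟨hT1, hT2⟩ := hT
  rcases lt_or_ge (torusWeight p r c) (p * (r + 1)) with h | h
  · have h' : (torusWeight p r c : ℝ) < p * (r + 1) := by exact_mod_cast h
    rw [if_neg (by omega), sign_pos (by linarith), sign_pos (by linarith)]
    rfl
  · have h := lt_of_le_of_ne h h0.symm
    have h' : (p * (r + 1) : ℝ) < torusWeight p r c := by exact_mod_cast h
    rcases le_or_gt (torusWeight p r c) (p * (r + 1) + l) with h2 | h2
    · have h2' : (torusWeight p r c : ℝ) ≤ p * (r + 1) + l := by exact_mod_cast h2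
      rw [if_pos ⟨h, h2⟩, sign_pos (by linarith), sign_neg (by linarith)]
      rfl
    · have h2' : (p * (r + 1) + l + 1 : ℝ) ≤ torusWeight p r c := by exact_mod_cast h2
      rw [if_neg (by omega), sign_neg (by linarith), sign_neg (by linarith)]
      rfl

/-- Scale by `pq` and split the absolute value. Replacing `j` by `p - j` rewrites `T - kp + jq` as
`T + pq` minus a weight. -/
theorem sum_sign_eq_sub_torusSignSum (hp : 1 ≤ p) (t : ℝ) :
    ∑ c : Fin r × Fin (p - 1),
      (SignType.sign (|t - (c.1 + 1) / (r + 1)| - (c.2 + 1) / ((p - 1 : ℕ) + 1)) : ℤ) =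
    (∑ c, (1 + (SignType.sign (p * (r + 1) * t - torusWeight p r c) : ℤ))) -
      torusSignSum p r (p * (r + 1) * t) := by
  have hp0 : (0 : ℝ) < p := by exact_mod_cast hp
  have hr0 : (0 : ℝ) < r + 1 := by positivity
  have hp1 : ((p - 1 : ℕ) : ℝ) + 1 = p := by rw [Nat.cast_sub hp]; simp
  have h1 : ∀ c : Fin r × Fin (p - 1),
      (SignType.sign (|t - (c.1 + 1) / (r + 1)| - (c.2 + 1) / ((p - 1 : ℕ) + 1)) : ℤ) =
      (1 + (SignType.sign (p * (r + 1) * t - torusWeight p r c) : ℤ)) -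
        SignType.sign (p * (r + 1) * t + p * (r + 1) - torusWeight p r (c.1, Fin.rev c.2)) := by
    intro c
    have h2 : SignType.sign (|t - (c.1 + 1) / (r + 1)| - (c.2 + 1) / ((p - 1 : ℕ) + 1)) =
        SignType.sign (|p * (r + 1) * t - (c.1 + 1) * p| - (c.2 + 1) * (r + 1)) := by
      have h3 : |p * (r + 1) * t - (c.1 + 1) * p| - (c.2 + 1) * (r + 1) =
          (p * (r + 1)) * (|t - (c.1 + 1) / (r + 1)| - (c.2 + 1) / ((p - 1 : ℕ) + 1)) := by
        have h4 : p * (r + 1) * t - (c.1 + 1) * p =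
            (p * (r + 1)) * (t - (c.1 + 1) / (r + 1)) := by field_simp
        rw [h4, abs_mul, abs_of_pos (mul_pos hp0 hr0), hp1]
        field_simp
      rw [h3, sign_mul, sign_pos (mul_pos hp0 hr0), one_mul]
    rw [h2, sign_abs_sub (by positivity)]
    have h5 : ((Fin.rev c.2 : ℕ) : ℝ) = p - 1 - (c.2 + 1) := by
      rw [Fin.val_rev, Nat.cast_sub c.2.isLt, Nat.cast_sub hp]; push_cast; ring
    have h6 : p * (r + 1) * t - (c.1 + 1) * p - (c.2 + 1) * (r + 1) =
        p * (r + 1) * t - torusWeight p r c := by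
      simp only [torusWeight]; push_cast; ring
    have h7 : p * (r + 1) * t - (c.1 + 1) * p + (c.2 + 1) * (r + 1) =
        p * (r + 1) * t + p * (r + 1) - torusWeight p r (c.1, Fin.rev c.2) := by
      simp only [torusWeight]; push_cast; rw [h5]; ring
    rw [h6, h7]
  rw [Finset.sum_congr rfl fun c _ => h1 c, Finset.sum_sub_distrib]
  congr 1
  exact ((Equiv.refl (Fin r)).prodCongr (Fin.revPerm (n := p - 1))).sum_comp fun c =>
    (SignType.sign (p * (r + 1) * t + p * (r + 1) - torusWeight p r c) : ℤ)

theorem sum_one_add_sign_eq_zero {T : ℝ} (hT : T < p + (r + 1)) :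
    ∑ c, (1 + (SignType.sign (T - torusWeight p r c) : ℤ)) = 0 := by
  refine Finset.sum_eq_zero fun c _ => ?_
  have : ((p + (r + 1) : ℕ) : ℝ) ≤ torusWeight p r c := by exact_mod_cast add_le_torusWeight c
  push_cast at this
  rw [sign_neg (by linarith)]
  rfl

/-- Only the smallest weight `p + q`, attained once, lies below `T`. -/
theorem sum_one_add_sign_eq_two (hp : 2 ≤ p) (hr : 1 ≤ r) (hcop : p.Coprime (r + 1)) {T : ℝ}
    (hT : T ∈ Set.Ioo (p + (r + 1) : ℝ) (p + (r + 1) + 1)) :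
    ∑ c, (1 + (SignType.sign (T - torusWeight p r c) : ℤ)) = 2 := by
  set c₀ : Fin r × Fin (p - 1) := (⟨0, by omega⟩, ⟨0, by omega⟩)
  have h0 : torusWeight p r c₀ = p + (r + 1) := by simp [torusWeight, c₀]; ring
  rw [Finset.sum_eq_single c₀]
  · have h0' : (torusWeight p r c₀ : ℝ) = p + (r + 1) := by exact_mod_cast h0
    rw [h0', sign_pos (by linarith [hT.1])]
    rfl
  · intro c _ hc
    have h1 := add_le_torusWeight c
    have h2 : torusWeight p r c ≠ p + (r + 1) := h0 ▸ (torusWeight_injective hcop).ne hc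
    have h3 : ((p + (r + 1) + 1 : ℕ) : ℝ) ≤ torusWeight p r c := by
      exact_mod_cast lt_of_le_of_ne h1 h2.symm
    push_cast at h3
    rw [sign_neg (by linarith [hT.2])]
    rfl
  · simp

end Signs

/-! ### Jumps -/

section Jumps

variable {σ : ℝ → ℤ} {t : ℝ}

theorem hasJump_of_eq {x y : ℝ} {a b : ℤ} (ht : t ∈ Set.Ioo (0 : ℝ) 1) (hx : x < t) (hy : t < y)
    (ha : ∀ s ∈ Set.Ioo x t, σ s = a) (hb : ∀ s ∈ Set.Ioo t y, σ s = b) :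
    HasJump σ t (b - a) :=
  ⟨ht, a, b,
    tendsto_const_nhds.congr' (by filter_upwards [Ioo_mem_nhdsLT hx] with s hs using (ha s hs).symm),
    tendsto_const_nhds.congr' (by filter_upwards [Ioo_mem_nhdsGT hy] with s hs using (hb s hs).symm),
    rfl⟩

theorem HasJump.unique {i j : ℤ} (hi : HasJump σ t i) (hj : HasJump σ t j) : i = j := by
  obtain ⟨_, a, b, ha, hb, rfl⟩ := hi
  obtain ⟨_, a', b', ha', hb', rfl⟩ := hj
  rw [tendsto_nhds_unique ha ha', tendsto_nhds_unique hb hb']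

theorem HasJump.isJumpPoint_iff {j : ℤ} (hj : HasJump σ t j) : IsJumpPoint σ t ↔ j ≠ 0 :=
  ⟨fun ⟨_, hi, h⟩ => h.unique hj ▸ hi, fun h => ⟨j, h, hj⟩⟩

end Jumps

/-! ### The signature function of a torus knot near zero -/

section TorusKnot

variable {p r n : ℕ} {M : Matrix (Fin n) (Fin n) ℤ}

/-- On one strand the surface is a disk, so the empty matrix is a Seifert matrix. -/
theorem tristramLevineSignature_torusBraid_one
    (hM : IsSeifertMatrix (torusBraid 1 (r + 1)) M) (t : ℝ) : tristramLevineSignature M t = 0 := by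
  by_cases h : Complex.exp (2 * Real.pi * Complex.I * t) = 1
  · exact tristramLevineSignature_eq_zero M h
  · refine tristramLevineSignature_eq_of_hasSignature
      (hM.hasSignature (sub_ne_zero.2 (Ne.symm h)) (torusBraidBasis 1 r) ?_)
    have : IsEmpty (Fin r × Fin (1 - 1)) := ⟨fun x => Fin.elim0 x.2⟩
    exact ⟨1, 0, by simp, Subsingleton.elim _ _, by simp⟩

theorem tristramLevineSignature_torusBraid_eq (hp : 1 ≤ p)
    (hM : IsSeifertMatrix (torusBraid p (r + 1)) M) {t : ℝ} (ht : t ∈ Set.Ioo (0 : ℝ) 1) :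
    tristramLevineSignature M t =
      (∑ c, (1 + (SignType.sign (p * (r + 1) * t - torusWeight p r c) : ℤ))) -
        torusSignSum p r (p * (r + 1) * t) := by
  rw [tristramLevineSignature_torusBraid hM ht, sum_sign_eq_sub_torusSignSum hp]

theorem tristramLevineSignature_torusBraid_eq_neg (hp : 2 ≤ p) (hpq : p < r + 1)
    (hM : IsSeifertMatrix (torusBraid p (r + 1)) M) {t : ℝ}
    (ht : t ∈ Set.Ico (0 : ℝ) ((p + ((r + 1 : ℕ) : ℝ)) / (p * ((r + 1 : ℕ) : ℝ)))) :
    tristramLevineSignature M t = -torusSignSum p r (p * ((r + 1 : ℕ) : ℝ) * t) := by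
  -- At `t = 0` the form is degenerate and S-equivalence gives nothing, but both sides are zero.
  rcases ht.1.eq_or_lt with rfl | ht0
  · rw [tristramLevineSignature_eq_zero M (by simp), mul_zero, torusSignSum_zero (by omega),
      neg_zero]
  · have hp0 : (0 : ℝ) < p := by exact_mod_cast (by omega : 0 < p)
    have hpq0 : (0 : ℝ) < p * ((r + 1 : ℕ) : ℝ) := by positivity
    have hlt : (p : ℝ) + ((r + 1 : ℕ) : ℝ) < p * ((r + 1 : ℕ) : ℝ) := by
      exact_mod_cast add_lt_mul_of_lt hp hpq
    have ht1 : t < 1 := ht.2.trans ((div_lt_one hpq0).2 hlt)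
    have hT := (lt_div_iff₀' hpq0).1 ht.2
    push_cast at hT ⊢
    rw [tristramLevineSignature_torusBraid_eq (by omega) hM ⟨ht0, ht1⟩,
      sum_one_add_sign_eq_zero hT, zero_sub]

theorem tristramLevineSignature_torusBraid_of_lt (hp : 2 ≤ p) (hpq : p < r + 1)
    (hcop : p.Coprime (r + 1)) (hM : IsSeifertMatrix (torusBraid p (r + 1)) M) {l : ℕ}
    (hl : l < p + (r + 1)) {t : ℝ}
    (ht : t ∈ Set.Ioo ((l : ℝ) / (p * ((r + 1 : ℕ) : ℝ))) ((l + 1) / (p * ((r + 1 : ℕ) : ℝ)))) :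
    tristramLevineSignature M t =
      -2 * (((Finset.Ioc 0 l).filter fun x => ¬ p ∣ x ∧ ¬ (r + 1) ∣ x).card : ℤ) := by
  have hp0 : (0 : ℝ) < p := by exact_mod_cast (by omega : 0 < p)
  have hpq0 : (0 : ℝ) < p * ((r + 1 : ℕ) : ℝ) := by positivity
  have ht0 : 0 ≤ t := (by positivity : (0 : ℝ) ≤ l / (p * ((r + 1 : ℕ) : ℝ))).trans ht.1.le
  have hl' : (l : ℝ) + 1 ≤ p + ((r + 1 : ℕ) : ℝ) := by exact_mod_cast hl
  have ht' : t < (p + ((r + 1 : ℕ) : ℝ)) / (p * ((r + 1 : ℕ) : ℝ)) :=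
    ht.2.trans_le (div_le_div_of_nonneg_right hl' hpq0.le)
  rw [tristramLevineSignature_torusBraid_eq_neg hp hpq hM ⟨ht0, ht'⟩,
    torusSignSum_eq (by omega) hcop ⟨(div_lt_iff₀' hpq0).1 ht.1, (lt_div_iff₀' hpq0).1 ht.2⟩,
    card_torusWeight hcop hl]
  ring

theorem tristramLevineSignature_torusBraid_above (hp : 2 ≤ p) (hpq : p < r + 1)
    (hcop : p.Coprime (r + 1)) (hM : IsSeifertMatrix (torusBraid p (r + 1)) M) {t : ℝ}
    (ht : t ∈ Set.Ioo ((p + ((r + 1 : ℕ) : ℝ)) / (p * ((r + 1 : ℕ) : ℝ)))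
      ((p + ((r + 1 : ℕ) : ℝ) + 1) / (p * ((r + 1 : ℕ) : ℝ)))) :
    tristramLevineSignature M t =
      2 - 2 * (((Finset.Ioc 0 (p + r)).filter fun x => ¬ p ∣ x ∧ ¬ (r + 1) ∣ x).card : ℤ) := by
  have hp0 : (0 : ℝ) < p := by exact_mod_cast (by omega : 0 < p)
  have hpq0 : (0 : ℝ) < p * ((r + 1 : ℕ) : ℝ) := by positivity
  have ht0 : 0 < t := lt_trans (by positivity) ht.1
  have hlt : (p : ℝ) + ((r + 1 : ℕ) : ℝ) + 1 ≤ p * ((r + 1 : ℕ) : ℝ) := by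
    exact_mod_cast (add_lt_mul_of_lt hp hpq : p + (r + 1) < _)
  have ht1 : t < 1 := ht.2.trans_le ((div_le_one hpq0).2 hlt)
  have hT1 := (div_lt_iff₀' hpq0).1 ht.1
  have hT2 := (lt_div_iff₀' hpq0).1 ht.2
  push_cast at hT1 hT2
  rw [tristramLevineSignature_torusBraid_eq (by omega) hM ⟨ht0, ht1⟩,
    sum_one_add_sign_eq_two hp (by omega) hcop ⟨hT1, hT2⟩,
    torusSignSum_eq (l := p + (r + 1)) (by omega) hcop (by push_cast; exact ⟨hT1, hT2⟩),
    ← card_torusWeight hcop (by omega)]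
  -- The count up to `p + q` equals the count up to `p + r = p + q - 1`, because `pq + p + q` is not
  -- a weight.
  congr 4
  ext c
  have := torusWeight_ne hcop c
  simp only [Finset.mem_filter, Finset.mem_univ, true_and]
  omega

end TorusKnot

/-! ### Jumps and values in the stated range -/

theorem lemma3p2 (p q : ℕ) (hp : 0 < p) (hpq : p < q) (hcop : p.Coprime q)
    {n : ℕ} (M : Matrix (Fin n) (Fin n) ℤ) (hM : IsSeifertMatrix (torusBraid p q) M) :
    AntitoneOn (tristramLevineSignature M) (Set.Ico (0 : ℝ) ((p + q) / (p * q))) ∧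
    (∀ t ∈ Set.Ico (0 : ℝ) ((p + q) / (p * q)),
      (IsJumpPoint (tristramLevineSignature M) t ↔
        ∃ ℓ : ℤ, t = ℓ / (p * q) ∧ ¬ (p : ℤ) ∣ ℓ ∧ ¬ (q : ℤ) ∣ ℓ) ∧
      (IsJumpPoint (tristramLevineSignature M) t → HasJump (tristramLevineSignature M) t (-2))) ∧
    (2 ≤ p → HasJump (tristramLevineSignature M) ((p + q) / (p * q)) 2) ∧
    (∀ ℓ : ℕ, ℓ < p + q → ∀ t ∈ Set.Ioo ((ℓ : ℝ) / (p * q)) ((ℓ + 1) / (p * q)), t < 1 →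
      tristramLevineSignature M t = -2 * ((ℓ : ℤ) - ⌊(ℓ : ℚ) / q⌋ - ⌊(ℓ : ℚ) / p⌋)) ∧
    (2 ≤ p → ∀ t ∈ Set.Ioo (((p : ℝ) + q) / (p * q)) ((p + q + 1) / (p * q)),
      tristramLevineSignature M t = -2 * ((p : ℤ) + q - 4 - ⌊(q : ℚ) / p⌋)) := by
  obtain ⟨r, rfl⟩ : ∃ r, q = r + 1 := ⟨q - 1, by omega⟩
  have hq0 : (0 : ℝ) < ((r + 1 : ℕ) : ℝ) := by positivity
  have hp0 : (0 : ℝ) < p := by exact_mod_cast hp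
  have hpq0 : (0 : ℝ) < p * ((r + 1 : ℕ) : ℝ) := mul_pos hp0 hq0
  -- For `p = 1` the interval extends beyond 1 and `p + q < pq` fails; here the signature vanishes
  -- identically.
  rcases Nat.lt_or_ge p 2 with hp1 | hp2
  · obtain rfl : p = 1 := by omega
    have h0 := tristramLevineSignature_torusBraid_one hM
    have hjump : ∀ t, ¬ IsJumpPoint (tristramLevineSignature M) t := by
      rintro t ⟨j, hj, h⟩
      refine hj (h.unique (hasJump_of_eq (a := 0) (b := 0) h.1 (sub_one_lt t) (lt_add_one t) ?_ ?_))
      all_goals exact fun s _ => h0 s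
    refine ⟨fun s _ t _ _ => by rw [h0, h0], fun t _ => ⟨⟨fun h => (hjump t h).elim, ?_⟩,
      fun h => (hjump t h).elim⟩, by omega, ?_, by omega⟩
    · rintro ⟨l, -, hl, -⟩
      exact absurd (by simp) hl
    · intro l hl t ht ht1
      -- This uses `t < 1`: it makes `⌊l/q⌋` zero, so the formula reads `l - 0 - l`.
      have hlt : l < r + 1 := by
        rw [Nat.cast_one, one_mul] at ht
        have h1 := ht.1.trans ht1
        rw [div_lt_one hq0] at h1
        exact_mod_cast h1
      rw [h0, Rat.floor_natCast_div_natCast, Rat.floor_natCast_div_natCast, ← Int.natCast_div,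
        Nat.div_eq_of_lt hlt]
      simp
  have hlt : p + (r + 1) + 1 ≤ p * (r + 1) := add_lt_mul_of_lt hp2 hpq
  have hltR : (p : ℝ) + ((r + 1 : ℕ) : ℝ) + 1 ≤ p * ((r + 1 : ℕ) : ℝ) := by exact_mod_cast hlt
  have hr : 1 ≤ r := by omega
  have hbelow := fun l hl t ht =>
    tristramLevineSignature_torusBraid_of_lt hp2 hpq hcop hM (l := l) hl (t := t) ht
  have habove := fun t ht => tristramLevineSignature_torusBraid_above hp2 hpq hcop hM (t := t) ht
  have hjumpAt : ∀ l : ℕ, 0 < l → l < p + (r + 1) → HasJump (tristramLevineSignature M)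
      (l / (p * ((r + 1 : ℕ) : ℝ))) (if ¬ p ∣ l ∧ ¬ (r + 1) ∣ l then -2 else 0) := by
    intro l hl0 hl
    obtain ⟨l, rfl⟩ : ∃ l', l = l' + 1 := ⟨l - 1, by omega⟩
    have hlR : ((l + 1 : ℕ) : ℝ) < p * ((r + 1 : ℕ) : ℝ) := by
      exact_mod_cast hl.trans_le (by omega)
    have h := hasJump_of_eq (σ := tristramLevineSignature M)
      (t := ((l + 1 : ℕ) : ℝ) / (p * ((r + 1 : ℕ) : ℝ)))
      ⟨by positivity, (div_lt_one hpq0).2 hlR⟩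
      (div_lt_div_of_pos_right (by push_cast; linarith : (l : ℝ) < ((l + 1 : ℕ) : ℝ)) hpq0)
      (div_lt_div_of_pos_right (lt_add_one ((l + 1 : ℕ) : ℝ)) hpq0)
      (fun s hs => hbelow l (by omega) s (by push_cast at hs ⊢; exact hs))
      (fun s hs => hbelow (l + 1) hl s hs)
    convert h using 1
    -- The counts on the two sides differ by the single candidate `l + 1`.
    have hins : Finset.Ioc 0 (l + 1) = insert (l + 1) (Finset.Ioc 0 l) :=
      (Finset.insert_Ioc_right_eq_Ioc_succ (Nat.zero_le l)).symm
    rw [hins, Finset.filter_insert]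
    have hnot : l + 1 ∉ (Finset.Ioc 0 l).filter fun x => ¬ p ∣ x ∧ ¬ (r + 1) ∣ x := by simp
    split_ifs with hd
    · rw [Finset.card_insert_of_notMem hnot]
      push_cast
      ring
    · ring
  have hjump : ∀ t ∈ Set.Ico (0 : ℝ) ((p + ((r + 1 : ℕ) : ℝ)) / (p * ((r + 1 : ℕ) : ℝ))),
      (IsJumpPoint (tristramLevineSignature M) t ↔ ∃ ℓ : ℤ, t = ℓ / (p * ((r + 1 : ℕ) : ℝ)) ∧
        ¬ (p : ℤ) ∣ ℓ ∧ ¬ ((r + 1 : ℕ) : ℤ) ∣ ℓ) ∧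
      (IsJumpPoint (tristramLevineSignature M) t →
        HasJump (tristramLevineSignature M) t (-2)) := by
    intro t ht
    rcases ht.1.eq_or_lt with rfl | ht0
    · have hno : ¬ IsJumpPoint (tristramLevineSignature M) 0 := fun ⟨_, _, h⟩ => h.1.1.false
      refine ⟨⟨fun h => (hno h).elim, ?_⟩, fun h => (hno h).elim⟩
      rintro ⟨l, hl, hlp, -⟩
      rw [eq_comm, div_eq_zero_iff, or_iff_left hpq0.ne', Int.cast_eq_zero] at hl
      exact absurd (hl ▸ dvd_zero _) hlp
    have hT : t * (p * ((r + 1 : ℕ) : ℝ)) < p + ((r + 1 : ℕ) : ℝ) := (lt_div_iff₀ hpq0).1 ht.2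
    have ht1 : t < 1 := by
      have := ht.2.trans_le ((div_le_one hpq0).2 (by linarith))
      exact this
    set T := t * (p * ((r + 1 : ℕ) : ℝ)) with hTdef
    have hT0 : 0 < T := mul_pos ht0 hpq0
    have htT : t = T / (p * ((r + 1 : ℕ) : ℝ)) := by rw [hTdef, mul_div_cancel_right₀ _ hpq0.ne']
    have hfloor := Nat.floor_le hT0.le
    have hfloor' := Nat.lt_floor_add_one T
    set l := ⌊T⌋₊
    have hl : l < p + (r + 1) := by
      have : (l : ℝ) < ((p + (r + 1) : ℕ) : ℝ) := by push_cast at hT ⊢; linarith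
      exact_mod_cast this
    -- If `pqt` is an integer, `hjumpAt` decides; otherwise `t` lies inside an interval on which the
    -- signature is constant.
    rcases hfloor.eq_or_lt with hlT | hlT
    · have hl0 : 0 < l := by
        rw [← hlT] at hT0
        exact_mod_cast hT0
      rw [htT, ← hlT]
      have h := hjumpAt l hl0 hl
      rw [h.isJumpPoint_iff]
      have hex : (∃ ℓ : ℤ, (l : ℝ) / (p * ((r + 1 : ℕ) : ℝ)) = ℓ / (p * ((r + 1 : ℕ) : ℝ)) ∧
          ¬ (p : ℤ) ∣ ℓ ∧ ¬ ((r + 1 : ℕ) : ℤ) ∣ ℓ) ↔ ¬ p ∣ l ∧ ¬ (r + 1) ∣ l := by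
        constructor
        · rintro ⟨ℓ, h1, h2⟩
          rw [div_left_inj' hpq0.ne'] at h1
          obtain rfl : (l : ℤ) = ℓ := by exact_mod_cast h1
          rwa [Int.natCast_dvd_natCast, Int.natCast_dvd_natCast] at h2
        · intro h2
          refine ⟨l, by simp, ?_⟩
          rwa [Int.natCast_dvd_natCast, Int.natCast_dvd_natCast]
      rw [hex]
      split_ifs at h ⊢ with hd
      · exact ⟨by simp [hd], fun _ => h⟩
      · exact ⟨by simp [hd], fun h' => (h' rfl).elim⟩
    · have h := hasJump_of_eq (σ := tristramLevineSignature M) (t := t) ⟨ht0, ht1⟩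
        (by rw [htT]; exact div_lt_div_of_pos_right hlT hpq0)
        (by rw [htT]; exact div_lt_div_of_pos_right hfloor' hpq0)
        (fun s hs => hbelow l hl s ⟨hs.1, hs.2.trans
          (by rw [htT]; exact div_lt_div_of_pos_right hfloor' hpq0)⟩)
        (fun s hs => hbelow l hl s ⟨lt_trans
          (by rw [htT]; exact div_lt_div_of_pos_right hlT hpq0) hs.1, hs.2⟩)
      rw [sub_self] at h
      have hno : ¬ IsJumpPoint (tristramLevineSignature M) t := by simp [h.isJumpPoint_iff]
      refine ⟨⟨fun h => (hno h).elim, ?_⟩, fun h => (hno h).elim⟩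
      rintro ⟨ℓ, h1, -⟩
      rw [htT, div_left_inj' hpq0.ne'] at h1
      rw [h1] at hlT hfloor'
      have h2 : (l : ℤ) < ℓ := by exact_mod_cast hlT
      have h3 : ℓ < (l : ℤ) + 1 := by exact_mod_cast hfloor'
      omega
  have hcard := card_not_dvd hp2 hpq hcop (l := p + r) (by omega)
  have h1 : (p + r) / (r + 1) = 1 := Nat.div_eq_of_lt_le (by omega) (by omega)
  -- Since `p ∤ q`, the quotients of `q - 1` and `q` by `p` agree.
  have h2 : (p + r) / p = (r + 1) / p + 1 := by
    rw [Nat.add_div_left _ hp, Nat.succ_div_of_not_dvd fun h => ?_]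
    have := hcop.eq_one_of_dvd h
    omega
  refine ⟨?_, hjump, fun _ => ?_, fun l hl t ht _ => ?_, fun _ t ht => ?_⟩
  · intro s hs t ht hst
    rw [tristramLevineSignature_torusBraid_eq_neg hp2 hpq hM hs,
      tristramLevineSignature_torusBraid_eq_neg hp2 hpq hM ht]
    exact neg_le_neg (torusSignSum_monotone (mul_le_mul_of_nonneg_left hst hpq0.le))
  · have h := hasJump_of_eq (σ := tristramLevineSignature M)
      (t := (p + ((r + 1 : ℕ) : ℝ)) / (p * ((r + 1 : ℕ) : ℝ)))
      ⟨by positivity, (div_lt_one hpq0).2 (by linarith)⟩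
      (div_lt_div_of_pos_right (by push_cast; linarith :
        ((p + r : ℕ) : ℝ) < p + ((r + 1 : ℕ) : ℝ)) hpq0)
      (div_lt_div_of_pos_right (lt_add_one (p + ((r + 1 : ℕ) : ℝ))) hpq0)
      (fun s hs => hbelow (p + r) (by omega) s ⟨hs.1, by
        have := hs.2
        push_cast at this ⊢
        rwa [← add_assoc] at this⟩)
      (fun s hs => habove s hs)
    convert h using 1
    ring
  · rw [hbelow l hl t ht, card_not_dvd hp2 hpq hcop hl, Rat.floor_natCast_div_natCast,
      Rat.floor_natCast_div_natCast]
    push_cast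
    ring
  · rw [habove t ht, hcard, h1, h2, Rat.floor_natCast_div_natCast]
    push_cast
    ring
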